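/- Let $K$ be an imaginary quadratic field of class number one with ring of integers $\mathcal O$. Let $\ell$ be a rational prime that splits in $\mathcal O$ as $\ell=\lambda\bar\lambda$ with $\lambda,\bar\lambda$ non-associate prime elements, let $\tau_1,\tau_2:\mathcal O\to\mathbb F_\ell$ be the reduction maps modulo $\lambda$ and modulo $\bar\lambda$, and let $\mathfrak a$ be an ideal of $\mathcal O$ that is prime to $(\ell)$. For an ideal $\mathfrak b$ put $$\Gamma_1(\mathfrak b)=\Bigl\{\begin{pmatrix} a&b\\ c&d\end{pmatrix}\in \mathrm{SL}_2(\mathcal O) : c\equiv d-1\equiv 0 \bmod \mathfrak b\Bigr\}.$$ Let $E$ be a right $\mathbb F_\ell[\mathrm{GL}_2(\mathcal O/(\ell))]$-module and $\Gamma=\Gamma_1(\mathfrak b)$. For a prime element $\pi$ of $\mathcal O$ that is coprime to $\ell$, let $\tilde\pi=\begin{pmatrix}\pi&0\\0&1\end{pmatrix}$ and write $\Gamma\tilde\pi\Gamma=\bigsqcup_i\gamma_i\Gamma$. The Hecke operator $T_\pi$ on $H^1(\Gamma,E)$ is given on cocycles (maps $c:\Gamma\to E$ with $c(gh)=c(g)\cdot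 h+c(h)$) by $$(T_\pi c)(g)=\sum_i c\bigl(\gamma_{j(i)}^{-1}g\gamma_i\bigr)\cdot\gamma_i^{\iota},\qquad \gamma_i^\iota=\det(\gamma_i)\gamma_i^{-1},$$ where $j(i)$ is the index with $\gamma_{j(i)}^{-1}g\gamma_i\in\Gamma$. The Hecke algebra $\mathbb H$ of $H^1(\Gamma,E)$ is the $\mathbb F_\ell$-subalgebra of its endomorphism algebra generated by all these $T_\pi$ (including those with $\pi\mid\mathfrak b$, $\pi\nmid\ell$). A Hecke eigenvalue system is a ring homomorphism $\Phi:\mathbb H\to\mathbb F_\ell$; it occurs in $H^1(\Gamma,E)$ if there is a nonzero $v\in H^1(\Gamma,E)$ with $Tv=\Phi(T)v$ for all $T\in\mathbb H$. **Corollary.** Let $E$ be a finite-dimensional right $\mathbb F_\ell[\mathrm{GL}_2(\mathcal O/(\ell))]$-module and let $\Phi$ be a Hecke eigenvalue system occurring in $H^1(\Gamma_1(\mathfrak a),E)$. Then $\Phi$ occurs, up to a determinant twist, in $H^1(\Gamma_1(\mathfrak a\ell),\mathbb F_\ell)$ with trivial coefficients: there are integers $0\le a,b\le \ell-2$ and a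 Hecke eigenvalue system $\Psi$ occurring in $H^1(\Gamma_1(\mathfrak a\ell),\mathbb F_\ell)$ such that $$\Phi(T_\pi)=\tau_1(\pi)^a\,\tau_2(\pi)^b\,\Psi(T_\pi)$$ for every prime element $\pi$ of $\mathcal O$ that is coprime to $\ell$. -/

import Mathlib

open NumberField MulOpposite

namespace Bianchi

noncomputable section

/-- The congruence subgroup `Γ₁(𝔟)` of `SL₂(R)`: the matrices `(a b; c d)` of determinant one with
`c ≡ d - 1 ≡ 0 mod 𝔟`. -/
def Gamma1 {R : Type} [CommRing R] (𝔟 : Ideal R) : Subgroup (Matrix.SpecialLinearGroup (Fin 2) R) where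
  carrier := {g | g 1 0 ∈ 𝔟 ∧ g 1 1 - 1 ∈ 𝔟}
  one_mem' := by simp
  mul_mem' := by
    rintro g h ⟨hg, hg'⟩ ⟨hh, hh'⟩
    have e0 : (g * h) 1 0 = g 1 0 * h 0 0 + g 1 1 * h 1 0 := by
      simp [Matrix.mul_apply, Fin.sum_univ_two]
    have e1 : (g * h) 1 1 = g 1 0 * h 0 1 + g 1 1 * h 1 1 := by
      simp [Matrix.mul_apply, Fin.sum_univ_two]
    refine ⟨?_, ?_⟩
    · rw [e0]
      exact 𝔟.add_mem (𝔟.mul_mem_right _ hg) (𝔟.mul_mem_left _ hh)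
    · have : (g * h) 1 1 - 1 = g 1 0 * h 0 1 + (g 1 1 * (h 1 1 - 1) + (g 1 1 - 1)) := by
        rw [e1]; ring
      rw [this]
      exact 𝔟.add_mem (𝔟.mul_mem_right _ hg) (𝔟.add_mem (𝔟.mul_mem_left _ hh') hg')
  inv_mem' := by
    rintro g ⟨hg, hg'⟩
    have hd : g 0 0 * g 1 1 - g 0 1 * g 1 0 = 1 := by
      have := g.det_coe
      rwa [Matrix.det_fin_two] at this
    have e0 : g⁻¹ 1 0 = - g 1 0 := by
      simp [Matrix.SpecialLinearGroup.coe_inv, Matrix.adjugate_fin_two]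
    have e1 : g⁻¹ 1 1 = g 0 0 := by
      simp [Matrix.SpecialLinearGroup.coe_inv, Matrix.adjugate_fin_two]
    refine ⟨?_, ?_⟩
    · rw [e0]
      exact 𝔟.neg_mem hg
    · have : g⁻¹ 1 1 - 1 = g 0 1 * g 1 0 - g 0 0 * (g 1 1 - 1) := by
        rw [e1]; linear_combination hd
      rw [this]
      exact 𝔟.sub_mem (𝔟.mul_mem_left _ hg) (𝔟.mul_mem_left _ hg')

section Hecke

variable {R : Type} [CommRing R] (Γ : Subgroup (Matrix.SpecialLinearGroup (Fin 2) R))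

/-- The matrix in `M₂(R)` underlying an element of `Γ`. -/
abbrev mat {Γ : Subgroup (Matrix.SpecialLinearGroup (Fin 2) R)} (g : Γ) : Matrix (Fin 2) (Fin 2) R :=
  ((g : Matrix.SpecialLinearGroup (Fin 2) R) : Matrix (Fin 2) (Fin 2) R)

/-- The matrix `α̃ = (α 0; 0 1)`. -/
def tildeMat (α : R) : Matrix (Fin 2) (Fin 2) R := !![α, 0; 0, 1]

lemma det_tildeMat (α : R) : (tildeMat α).det = α := by simp [tildeMat]

lemma tildeMat_cancel [IsDomain R] {α : R} (hα : α ≠ 0) {M N : Matrix (Fin 2) (Fin 2) R}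
    (h : tildeMat α * M = tildeMat α * N) : M = N := by
  have h00 := congrFun (congrFun h 0) 0
  have h01 := congrFun (congrFun h 0) 1
  have h10 := congrFun (congrFun h 1) 0
  have h11 := congrFun (congrFun h 1) 1
  simp [tildeMat, Matrix.mul_apply, Fin.sum_univ_two, hα] at h00 h01 h10 h11
  ext i j
  fin_cases i <;> fin_cases j <;> assumption

/-- The group `Γ^α = Γ ∩ α̃ Γ α̃⁻¹`, as a subgroup of `Γ`. -/
def upperSubgroup (α : R) : Subgroup Γ where
  carrier := {g | ∃ h : Γ, mat g * tildeMat α = tildeMat α * mat h}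
  one_mem' := by
    refine ⟨1, ?_⟩
    change (1 : Matrix (Fin 2) (Fin 2) R) * tildeMat α = tildeMat α * 1
    rw [Matrix.one_mul, Matrix.mul_one]
  mul_mem' := by
    rintro g g' ⟨h, hh⟩ ⟨h', hh'⟩
    refine ⟨h * h', ?_⟩
    change mat g * mat g' * tildeMat α = tildeMat α * (mat h * mat h')
    rw [Matrix.mul_assoc, hh', ← Matrix.mul_assoc, hh, Matrix.mul_assoc]
  inv_mem' := by
    rintro g ⟨h, hh⟩
    refine ⟨h⁻¹, ?_⟩
    have hg : mat g⁻¹ * mat g = 1 := by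
      rw [← Matrix.SpecialLinearGroup.coe_mul, ← Subgroup.coe_mul]; simp
    have hh1 : mat h * mat h⁻¹ = 1 := by
      rw [← Matrix.SpecialLinearGroup.coe_mul, ← Subgroup.coe_mul]; simp
    calc mat g⁻¹ * tildeMat α = mat g⁻¹ * (tildeMat α * mat h) * mat h⁻¹ := by
          rw [Matrix.mul_assoc, Matrix.mul_assoc, hh1, Matrix.mul_one]
      _ = mat g⁻¹ * mat g * tildeMat α * mat h⁻¹ := by rw [← hh]; simp only [Matrix.mul_assoc]
      _ = tildeMat α * mat h⁻¹ := by rw [hg, Matrix.one_mul]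

/-- The set `Γ / Γ^α`. It indexes the cosets in `Γ α̃ Γ = ⨆ γᵢ Γ` through `x ↦ x α̃ Γ`. -/
abbrev HeckeIndex (α : R) : Type := Γ ⧸ upperSubgroup Γ α

/-- There are only finitely many cosets, so that the sums over `HeckeIndex` below are honest. -/
lemma finite_heckeIndex [Ring.HasFiniteQuotients R] (𝔟 : Ideal R) {α : R} (hα : α ≠ 0) :
    Finite (HeckeIndex (Gamma1 𝔟) α) := by
  have : Finite (R ⧸ Ideal.span {α}) :=
    Ring.HasFiniteQuotients.finiteQuotient (by simpa using hα)
  have : Finite (Matrix.SpecialLinearGroup (Fin 2) (R ⧸ Ideal.span {α})) := inferInstance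
  let f : Gamma1 𝔟 →* Matrix.SpecialLinearGroup (Fin 2) (R ⧸ Ideal.span {α}) :=
    (Matrix.SpecialLinearGroup.map (Ideal.Quotient.mk _)).comp (Gamma1 𝔟).subtype
  have hle : f.ker ≤ upperSubgroup (Gamma1 𝔟) α := by
    intro g hg
    have hb : Ideal.Quotient.mk (Ideal.span {α}) (mat g 0 1) = 0 := by
      have := congrArg (fun s : Matrix.SpecialLinearGroup (Fin 2) (R ⧸ Ideal.span {α}) => s 0 1)
        (MonoidHom.mem_ker.mp hg)
      simpa [f] using this
    obtain ⟨b, hb⟩ := Ideal.mem_span_singleton'.mp (Ideal.Quotient.eq_zero_iff_mem.mp hb)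
    have hd : mat g 0 0 * mat g 1 1 - mat g 0 1 * mat g 1 0 = 1 := by
      have := (g : Matrix.SpecialLinearGroup (Fin 2) R).det_coe
      rwa [Matrix.det_fin_two] at this
    have hmem := g.2
    refine ⟨⟨⟨!![mat g 0 0, b; α * mat g 1 0, mat g 1 1], ?_⟩, ?_, ?_⟩, ?_⟩
    · rw [Matrix.det_fin_two_of]
      rw [← hb] at hd
      linear_combination hd
    · simpa using 𝔟.mul_mem_left _ hmem.1
    · simpa using hmem.2
    · change mat g * tildeMat α =
        tildeMat α * !![mat g 0 0, b; α * mat g 1 0, mat g 1 1]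
      ext i j
      fin_cases i <;> fin_cases j <;>
        simp [tildeMat, Matrix.mul_apply, Fin.sum_univ_two, ← hb, mul_comm]
  have : f.ker.FiniteIndex := Subgroup.finiteIndex_ker f
  have : (upperSubgroup (Gamma1 𝔟) α).FiniteIndex := Subgroup.finiteIndex_of_le hle
  infer_instance

variable {Γ}

/-- The representative `γ = s α̃` of the coset of `Γ α̃ Γ / Γ` with index `x = s Γ^α`. -/
def cosetRep {α : R} (x : HeckeIndex Γ α) : Matrix (Fin 2) (Fin 2) R :=
  mat x.out * tildeMat α

lemma det_cosetRep {α : R} (x : HeckeIndex Γ α) : (cosetRep x).det = α := by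
  rw [cosetRep, Matrix.det_mul, det_tildeMat, Matrix.SpecialLinearGroup.det_coe, one_mul]

lemma exists_transfer {α : R} (g : Γ) (x : HeckeIndex Γ α) :
    ∃ h : Γ, mat g * cosetRep (g⁻¹ • x) = cosetRep x * mat h := by
  have hq : ((x.out : Γ) : HeckeIndex Γ α) = ((g * (g⁻¹ • x).out : Γ) : HeckeIndex Γ α) := by
    rw [QuotientGroup.out_eq', ← smul_eq_mul, ← MulAction.Quotient.smul_coe,
      QuotientGroup.out_eq', smul_inv_smul]
  obtain ⟨h, hh⟩ := QuotientGroup.eq.mp hq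
  refine ⟨h, ?_⟩
  rw [cosetRep, cosetRep, Matrix.mul_assoc, ← hh, ← Matrix.mul_assoc, ← Matrix.mul_assoc]
  congr 1
  simp only [mat, ← Matrix.SpecialLinearGroup.coe_mul, ← Subgroup.coe_mul, mul_inv_cancel_left]

/-- For `g ∈ Γ` and an index `x`, put `y = g⁻¹ x`; then `g γ_y ∈ γ_x Γ`, and `transfer g x` is the
element `γ_x⁻¹ g γ_y` of `Γ`. -/
def transfer {α : R} (g : Γ) (x : HeckeIndex Γ α) : Γ := (exists_transfer g x).choose

lemma transfer_spec {α : R} (g : Γ) (x : HeckeIndex Γ α) :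
    mat g * cosetRep (g⁻¹ • x) = cosetRep x * mat (transfer g x) :=
  (exists_transfer g x).choose_spec

lemma cosetRep_cancel [IsDomain R] {α : R} (hα : α ≠ 0) (x : HeckeIndex Γ α) {h h' : Γ}
    (H : cosetRep x * mat h = cosetRep x * mat h') : h = h' := by
  have hs : mat (x.out)⁻¹ * mat x.out = 1 := by
    rw [← Matrix.SpecialLinearGroup.coe_mul, ← Subgroup.coe_mul]; simp
  have := congrArg (fun M => mat (x.out)⁻¹ * M) H
  simp only [cosetRep, ← Matrix.mul_assoc, hs, Matrix.one_mul] at this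
  exact Subtype.ext (Subtype.ext (tildeMat_cancel hα this))

lemma transfer_mul [IsDomain R] {α : R} (hα : α ≠ 0) (g g' : Γ) (x : HeckeIndex Γ α) :
    transfer (g * g') x = transfer g x * transfer g' (g⁻¹ • x) := by
  apply cosetRep_cancel hα x
  have h1 := transfer_spec g x
  have h2 := transfer_spec g' (g⁻¹ • x)
  have h3 := transfer_spec (g * g') x
  simp only [mat, Subgroup.coe_mul, Matrix.SpecialLinearGroup.coe_mul] at *
  rw [← h3, ← Matrix.mul_assoc, ← h1, Matrix.mul_assoc, Matrix.mul_assoc, ← h2, smul_smul,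
    ← _root_.mul_inv_rev]

variable {k E : Type} [CommRing k] [AddCommGroup E] [Module k E] {𝔫 : Ideal R}
  (ρ : Representation k (GL (Fin 2) (R ⧸ 𝔫))ᵐᵒᵖ E)

/-- Right multiplication `v ↦ v · m` on a right `GL₂(R/𝔫)`-module by a matrix `m` over `R` whose
determinant is invertible modulo `𝔫`. -/
def rightMul (m : Matrix (Fin 2) (Fin 2) R) (hm : IsUnit (Ideal.Quotient.mk 𝔫 m.det)) :
    E →ₗ[k] E :=
  ρ (op (Matrix.GeneralLinearGroup.mk'' (m.map (Ideal.Quotient.mk 𝔫))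
    (by rwa [← RingHom.mapMatrix_apply, ← RingHom.map_det])))

lemma rightMul_mul (m n : Matrix (Fin 2) (Fin 2) R) (hm hn hmn) (v : E) :
    rightMul ρ (m * n) hmn v = rightMul ρ n hn (rightMul ρ m hm v) := by
  rw [rightMul, rightMul, rightMul, ← Module.End.mul_apply, ← map_mul, ← op_mul]
  congr 3
  apply Units.ext
  simp [Matrix.map_mul]

/-- The left action of `SL₂(R)` on a right `GL₂(R/𝔫)`-module `E` that is given by
`g • v = v · g⁻¹`. -/
def leftAction : Representation k (Matrix.SpecialLinearGroup (Fin 2) R) E :=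
  ρ.comp ((MulEquiv.inv' (GL (Fin 2) (R ⧸ 𝔫))).toMonoidHom.comp
    (Matrix.SpecialLinearGroup.toGL.comp (Matrix.SpecialLinearGroup.map (Ideal.Quotient.mk 𝔫))))

lemma leftAction_apply (g : Matrix.SpecialLinearGroup (Fin 2) R) (hg) (v : E) :
    leftAction ρ g v = rightMul ρ (Matrix.adjugate (g : Matrix (Fin 2) (Fin 2) R)) hg v := by
  simp only [leftAction, rightMul, MonoidHom.comp_apply]
  congr 2
  apply unop_injective
  apply Units.ext
  change ((Matrix.SpecialLinearGroup.toGL (Matrix.SpecialLinearGroup.map (Ideal.Quotient.mk 𝔫) g))⁻¹).val = _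
  rw [← map_inv, ← map_inv]
  rfl

variable (Γ) in
/-- The right `GL₂(R/𝔫)`-module `E`, as a coefficient module for the group `Γ`. -/
abbrev coeff : Rep k Γ := Rep.of ((leftAction ρ).comp Γ.subtype)

variable (Γ) in
/-- The cohomology group `H¹(Γ, E)`. A class is represented by maps `c : Γ → E` with
`c(gh) = c(h) · g⁻¹ + c(g)`; the substitution `g ↦ c(g⁻¹)` turns these into the right cocycles
`c'(gh) = c'(g) · h + c'(h)`. -/
abbrev H1 : Type := groupCohomology.H1 (coeff Γ ρ)

lemma isUnit_adjugate_cosetRep {α : R} (hα : IsUnit (Ideal.Quotient.mk 𝔫 α))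
    (x : HeckeIndex Γ α) :
    IsUnit (Ideal.Quotient.mk 𝔫 (Matrix.adjugate (cosetRep x)).det) := by
  rw [Matrix.det_adjugate, det_cosetRep]
  simpa using hα

/-- The map `v ↦ v · γ_x^ι`, where `γ^ι = det(γ) γ⁻¹` is the adjugate. -/
def iotaMul {α : R} (hα : IsUnit (Ideal.Quotient.mk 𝔫 α)) (x : HeckeIndex Γ α) : E →ₗ[k] E :=
  rightMul ρ (Matrix.adjugate (cosetRep x)) (isUnit_adjugate_cosetRep hα x)

lemma iotaMul_transfer {α : R} (hα : IsUnit (Ideal.Quotient.mk 𝔫 α)) (g : Γ)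
    (x : HeckeIndex Γ α) (v : E) :
    iotaMul ρ hα x (leftAction ρ (transfer g x) v) =
      leftAction ρ g (iotaMul ρ hα (g⁻¹ • x) v) := by
  have hu : ∀ h : Γ, IsUnit (Ideal.Quotient.mk 𝔫 (Matrix.adjugate (mat h)).det) := by
    intro h
    simp [Matrix.det_adjugate]
  have hp : ∀ a b : Matrix (Fin 2) (Fin 2) R, IsUnit (Ideal.Quotient.mk 𝔫 a.det) →
      IsUnit (Ideal.Quotient.mk 𝔫 b.det) → IsUnit (Ideal.Quotient.mk 𝔫 (a * b).det) := by
    intro a b ha hb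
    rw [Matrix.det_mul, map_mul]
    exact ha.mul hb
  rw [leftAction_apply ρ _ (hu _), leftAction_apply ρ _ (hu _), iotaMul, iotaMul,
    ← rightMul_mul ρ _ _ _ _ (hp _ _ (hu _) (isUnit_adjugate_cosetRep hα x)),
    ← rightMul_mul ρ _ _ _ _ (hp _ _ (isUnit_adjugate_cosetRep hα _) (hu _))]
  congr 1
  congr 1
  rw [← Matrix.adjugate_mul_distrib, ← Matrix.adjugate_mul_distrib, transfer_spec]

/-- The Hecke operator on cochains,
`(T_α c)(g) = ∑ₓ c(γ_x⁻¹ g γ_{g⁻¹x}) · γ_x^ι`. For the right cocycle `c'(g) = c(g⁻¹)` this reads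
`(T_α c')(g) = ∑ₓ c'(γ_{gx}⁻¹ g γ_x) · γ_x^ι`. -/
def heckeFun {α : R} (hα : IsUnit (Ideal.Quotient.mk 𝔫 α)) (c : Γ → E) : Γ → E :=
  fun g => ∑ᶠ x : HeckeIndex Γ α, iotaMul ρ hα x (c (transfer g x))

lemma heckeFun_mem_cocycles [IsDomain R] {α : R} (h0 : α ≠ 0) [Finite (HeckeIndex Γ α)]
    (hα : IsUnit (Ideal.Quotient.mk 𝔫 α)) {c : Γ → E}
    (hc : c ∈ groupCohomology.cocycles₁ (coeff Γ ρ)) :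
    heckeFun ρ hα c ∈ groupCohomology.cocycles₁ (coeff Γ ρ) := by
  rw [groupCohomology.mem_cocycles₁_iff] at hc ⊢
  intro g h
  change ∀ g h : Γ, c (g * h) = leftAction ρ g (c h) + c g at hc
  change heckeFun ρ hα c (g * h) = leftAction ρ g (heckeFun ρ hα c h) + heckeFun ρ hα c g
  have _ := Fintype.ofFinite (HeckeIndex Γ α)
  simp only [heckeFun, finsum_eq_sum_of_fintype]
  rw [map_sum]
  have : ∀ x : HeckeIndex Γ α, iotaMul ρ hα x (c (transfer (g * h) x)) =
      leftAction ρ g (iotaMul ρ hα (g⁻¹ • x) (c (transfer h (g⁻¹ • x)))) +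
        iotaMul ρ hα x (c (transfer g x)) := by
    intro x
    rw [transfer_mul h0, hc, map_add, iotaMul_transfer]
  simp only [this, Finset.sum_add_distrib]
  congr 1
  exact Fintype.sum_equiv (MulAction.toPerm g⁻¹) _ _ (fun x => rfl)

lemma heckeFun_mem_coboundaries {α : R} [Finite (HeckeIndex Γ α)]
    (hα : IsUnit (Ideal.Quotient.mk 𝔫 α)) {c : Γ → E}
    (hc : c ∈ groupCohomology.coboundaries₁ (coeff Γ ρ)) :
    heckeFun ρ hα c ∈ groupCohomology.coboundaries₁ (coeff Γ ρ) := by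
  obtain ⟨v, rfl⟩ := hc
  have _ := Fintype.ofFinite (HeckeIndex Γ α)
  refine ⟨(∑ x : HeckeIndex Γ α, iotaMul ρ hα x v : E), ?_⟩
  funext g
  change leftAction ρ g (∑ x : HeckeIndex Γ α, iotaMul ρ hα x v) -
    (∑ x : HeckeIndex Γ α, iotaMul ρ hα x v) =
    ∑ᶠ x : HeckeIndex Γ α, iotaMul ρ hα x (leftAction ρ (transfer g x) v - v)
  simp only [finsum_eq_sum_of_fintype, map_sub, iotaMul_transfer, Finset.sum_sub_distrib, map_sum]
  congr 1
  exact (Fintype.sum_equiv (MulAction.toPerm g⁻¹) _ _ (fun x => rfl)).symm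

/-- The Hecke operator on cocycles. -/
def heckeCocycles [IsDomain R] {α : R} (h0 : α ≠ 0) [Finite (HeckeIndex Γ α)]
    (hα : IsUnit (Ideal.Quotient.mk 𝔫 α)) :
    groupCohomology.cocycles₁ (coeff Γ ρ) →ₗ[k] groupCohomology.cocycles₁ (coeff Γ ρ) where
  toFun c := ⟨heckeFun ρ hα c.1, heckeFun_mem_cocycles ρ h0 hα c.2⟩
  map_add' c d := by
    have _ := Fintype.ofFinite (HeckeIndex Γ α)
    apply Subtype.ext
    funext g
    change heckeFun ρ hα (c.1 + d.1) g = heckeFun ρ hα c.1 g + heckeFun ρ hα d.1 g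
    simp only [heckeFun, finsum_eq_sum_of_fintype, ← Finset.sum_add_distrib, ← map_add]
    rfl
  map_smul' r c := by
    have _ := Fintype.ofFinite (HeckeIndex Γ α)
    apply Subtype.ext
    funext g
    change heckeFun ρ hα (r • c.1) g = r • heckeFun ρ hα c.1 g
    simp only [heckeFun, finsum_eq_sum_of_fintype, Finset.smul_sum, ← map_smul]
    rfl

lemma H1π_surjective :
    Function.Surjective (groupCohomology.H1π (coeff Γ ρ)).hom :=
  (ModuleCat.epi_iff_surjective _).mp inferInstance

/-- The Hecke operator `T_α` on `H¹(Γ, E)`: the map of quotients induced by `heckeCocycles`. -/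
def heckeOperator [IsDomain R] {α : R} (h0 : α ≠ 0) [Finite (HeckeIndex Γ α)]
    (hα : IsUnit (Ideal.Quotient.mk 𝔫 α)) : Module.End k (H1 Γ ρ) :=
  let e := (groupCohomology.H1π (coeff Γ ρ)).hom.quotKerEquivOfSurjective (H1π_surjective ρ)
  e.toLinearMap ∘ₗ
    Submodule.mapQ _ _ (heckeCocycles ρ h0 hα) (fun c hc => by
      rw [LinearMap.mem_ker] at hc
      rw [Submodule.mem_comap, LinearMap.mem_ker]
      exact (groupCohomology.H1π_eq_zero_iff _).mpr
        (heckeFun_mem_coboundaries ρ hα ((groupCohomology.H1π_eq_zero_iff _).mp hc))) ∘ₗ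
    e.symm.toLinearMap

lemma heckeOperator_H1π [IsDomain R] {α : R} (h0 : α ≠ 0) [Finite (HeckeIndex Γ α)]
    (hα : IsUnit (Ideal.Quotient.mk 𝔫 α)) (c : groupCohomology.cocycles₁ (coeff Γ ρ)) :
    heckeOperator ρ h0 hα (groupCohomology.H1π (coeff Γ ρ) c) =
      groupCohomology.H1π (coeff Γ ρ) (heckeCocycles ρ h0 hα c) := by
  set f := (groupCohomology.H1π (coeff Γ ρ)).hom with hf
  have : (f.quotKerEquivOfSurjective (H1π_surjective ρ)).symm (f c) = Submodule.Quotient.mk c := by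
    rw [LinearEquiv.symm_apply_eq, LinearMap.quotKerEquivOfSurjective_apply_mk]
  simp only [heckeOperator, LinearMap.comp_apply]
  change (f.quotKerEquivOfSurjective (H1π_surjective ρ)) (Submodule.mapQ _ _ _ _
    ((f.quotKerEquivOfSurjective (H1π_surjective ρ)).symm (f c))) = f _
  rw [this, Submodule.mapQ_apply, LinearMap.quotKerEquivOfSurjective_apply_mk]

end Hecke

section System

lemma isUnit_mk_of_isCoprime {R : Type} [CommRing R] {ℓ : ℕ} {α : R} (h : IsCoprime α (ℓ : R)) :
    IsUnit (Ideal.Quotient.mk (Ideal.span {(ℓ : R)}) α) := by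
  obtain ⟨a, b, hab⟩ := h
  refine IsUnit.of_mul_eq_one (Ideal.Quotient.mk _ a) ?_
  rw [← map_mul, ← map_one (Ideal.Quotient.mk _), Ideal.Quotient.eq,
    Ideal.mem_span_singleton']
  exact ⟨-b, by linear_combination -hab⟩

variable {K : Type} [Field K] [NumberField K] {ℓ : ℕ}

variable (K ℓ) in
/-- The prime elements of the ring of integers that are coprime to `ℓ`. -/
abbrev PrimeAway : Type := {π : 𝓞 K // Prime π ∧ IsCoprime π (ℓ : 𝓞 K)}

variable {E : Type} [AddCommGroup E] [Module (ZMod ℓ) E] (𝔟 : Ideal (𝓞 K))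
  (ρ : Representation (ZMod ℓ) (GL (Fin 2) (𝓞 K ⧸ Ideal.span {(ℓ : 𝓞 K)}))ᵐᵒᵖ E)

/-- The Hecke operator `T_π` on `H¹(Γ₁(𝔟), E)`, for a prime element `π` that is coprime to `ℓ`. -/
def T (π : PrimeAway K ℓ) : Module.End (ZMod ℓ) (H1 (Gamma1 𝔟) ρ) :=
  haveI := finite_heckeIndex 𝔟 π.2.1.ne_zero
  heckeOperator ρ π.2.1.ne_zero (isUnit_mk_of_isCoprime π.2.2)

/-- The Hecke algebra of `H¹(Γ₁(𝔟), E)`: the subalgebra of its endomorphism algebra that is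
generated by the operators `T_π`. -/
def heckeAlgebra : Subalgebra (ZMod ℓ) (Module.End (ZMod ℓ) (H1 (Gamma1 𝔟) ρ)) :=
  Algebra.adjoin (ZMod ℓ) (Set.range (T 𝔟 ρ))

/-- The operator `T_π`, as an element of the Hecke algebra. -/
def heckeT (π : PrimeAway K ℓ) : heckeAlgebra 𝔟 ρ :=
  ⟨T 𝔟 ρ π, Algebra.subset_adjoin ⟨π, rfl⟩⟩

variable {𝔟 ρ} in
/-- A system of eigenvalues `Φ` of the Hecke algebra occurs in `H¹(Γ₁(𝔟), E)`. -/
def Occurs (Φ : heckeAlgebra 𝔟 ρ →+* ZMod ℓ) : Prop :=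
  ∃ v : H1 (Gamma1 𝔟) ρ, v ≠ 0 ∧
    ∀ t : heckeAlgebra 𝔟 ρ, (t : Module.End (ZMod ℓ) (H1 (Gamma1 𝔟) ρ)) v = Φ t • v

variable (K ℓ) in
/-- The field `𝔽_ℓ` with the trivial (right) action of `GL₂(𝓞/(ℓ))`. -/
abbrev trivialCoeff :
    Representation (ZMod ℓ) (GL (Fin 2) (𝓞 K ⧸ Ideal.span {(ℓ : 𝓞 K)}))ᵐᵒᵖ (ZMod ℓ) :=
  Representation.trivial (ZMod ℓ) _ (ZMod ℓ)

end System

end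

end Bianchi

/-!
A system of Hecke eigenvalues in `H¹(Γ₁(𝔞), E)` is moved to trivial coefficients on the level of
cocycles. Write `G = GL₂(R/𝔫)` with `𝔫 = (ℓ)`, so that `R/𝔫 ≃ 𝔽_ℓ × 𝔽_ℓ`.

Among the `G`-stable subspaces of `E` choose a minimal one, `K`, with values in which there is a
cocycle `u` whose class is non-zero and an eigenclass for the given eigenvalues `μ_π` in
`H¹(Γ₁(𝔞), E)`. The group of the matrices `(1 y; 0 1)` over `R/𝔫` is an `ℓ`-group and that of the
`(1 0; 0 x)` is abelian of exponent dividing `ℓ - 1`, so there are a functional `f` that is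
non-zero on `K` and a character `χ` with `f(v · (1 y; 0 x)) = χ(x) f(v)` (`exists_semiinvariant`).
On `Γ₁(𝔞𝔫)` the functional `f` is invariant, hence `c ↦ f ∘ c` maps `K`-valued cocycles of `Γ₁(𝔞)`
to cocycles of `Γ₁(𝔞𝔫)` with trivial coefficients; since the cosets defining `T_π` can be
represented by the same matrices at both levels, this map carries `T_π` to `χ(π) T_π`
(`apply_heckeFun`). Let `N` be the image of the `K`-valued coboundaries, a finite-dimensional
Hecke-stable space of cocycles.

* If `f ∘ u ∉ N`, then `f ∘ u` is an eigenvector modulo `N` with eigenvalues `χ(π)⁻¹ μ_π`. The Hecke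
  operators on cocycles with trivial coefficients commute (`heckeFun_comm`), so a nilpotency argument
  in the finite-dimensional space spanned by `N` and `f ∘ u` gives an honest eigenvector with the
  same eigenvalues (`exists_eigenvector_of_quotient`). The class of a non-zero cocycle is non-zero
  here, as coboundaries with trivial coefficients vanish.

* If `f ∘ u ∈ N`, then `f ∘ u = 0` after a change of `u` by a coboundary. By Shapiro's lemma and
  strong approximation, `u` becomes the coboundary of a function `F` on `G`
  (`exists_toFunRep_eq_bd`).
  By the minimality of `K`, `F` is non-zero in a quotient of the space of functions on `G` where
  `T_π` acts on it as `deg T_π` times the torus element `(1 0; 0 π)`; therefore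
  `μ_π = deg T_π · ψ(π)` for a character `ψ` (`exists_character_of_toFunRep_eq_bd`). Up to a twist
  this is the system of eigenvalues of the homomorphism `(a b; c d) ↦ τ₁(b)` on `Γ₁(𝔞𝔫)`, whose
  `T_π`-eigenvalue is `deg T_π · τ₁(π)⁻¹` (`heckeFun_upperEntry`).

In both cases the twist is a character of `(R/𝔫)ˣ`, that is, `π ↦ τ₁(π)^a τ₂(π)^b`
(`exists_pow_mul_pow_of_hom`).
-/

namespace Bianchi

noncomputable section

/-! ### Common eigenvectors -/

section LinearAlgebra

variable {F V ι : Type*} [Field F] [AddCommGroup V] [Module F V]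

theorem coe_restrict_pow {f : Module.End F V} {M : Submodule F V} (h : ∀ v ∈ M, f v ∈ M) (k : ℕ)
    (x : M) : ((((f.restrict h) ^ k) x : M) : V) = (f ^ k) x := by
  induction k with
  | zero => rfl
  | succ k ih =>
    rw [pow_succ', pow_succ', Module.End.mul_apply, Module.End.mul_apply, ← ih]
    rfl

/-- A system of eigenvalues of a commuting family that is carried by a quotient of a
finite-dimensional space is carried by the space itself (here the eigenvalues are normalised to be
zero). No finiteness of the family is assumed; the proof passes to stable subspaces that are minimal
for suitable properties instead of treating the operators one at a time. -/
theorem exists_ne_zero_forall_apply_eq_zero [FiniteDimensional F V] {S : ι → Module.End F V}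
    (hc : ∀ i j, Commute (S i) (S j)) {N : Submodule F V} (hN : N ≠ ⊤) (hS : ∀ i v, S i v ∈ N) :
    ∃ w : V, w ≠ 0 ∧ ∀ i, S i w = 0 := by
  have hc' : ∀ i j v, S i (S j v) = S j (S i v) := fun i j v =>
    congrArg (fun f : Module.End F V => f v) (hc i j)
  have hcp : ∀ i j n v, (S i ^ n) (S j v) = S j ((S i ^ n) v) := fun i j n v =>
    congrArg (fun f : Module.End F V => f v) ((hc i j).pow_left n)
  obtain ⟨M, ⟨hMs, hMN⟩, hMmin⟩ := exists_minimal_of_wellFoundedLT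
    (fun M : Submodule F V => (∀ i, ∀ v ∈ M, S i v ∈ M) ∧ ¬ M ≤ N)
    ⟨⊤, by simp, by simpa using hN⟩
  -- In the Fitting decomposition of `M` under `S j` the image part lies in `N`, so by minimality
  -- `M` is the kernel part, and `S j` is nilpotent on `M`.
  have hnil : ∀ j, ∃ n, ∀ v ∈ M, (S j ^ n) v = 0 := by
    intro j
    let s : Module.End F M := (S j).restrict (hMs j)
    obtain ⟨n, hn⟩ := Filter.eventually_atTop.mp s.eventually_isCompl_ker_pow_range_pow
    have hcomp := hn (n + 1) (by omega)
    have hpow := coe_restrict_pow (hMs j)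
    refine ⟨n + 1, fun v hv => ?_⟩
    have hker : M ≤ M ⊓ LinearMap.ker (S j ^ (n + 1)) := by
      refine hMmin ⟨fun i v hv => ⟨hMs i v hv.1, LinearMap.mem_ker.mpr ?_⟩,
        fun hle => hMN fun v hv => ?_⟩ inf_le_left
      · rw [hcp, LinearMap.mem_ker.mp hv.2, map_zero]
      · have : (⟨v, hv⟩ : M) ∈ LinearMap.ker (s ^ (n + 1)) ⊔ LinearMap.range (s ^ (n + 1)) := by
          rw [hcomp.sup_eq_top]; trivial
        obtain ⟨a, ha, b, ⟨c, rfl⟩, hab⟩ := Submodule.mem_sup.mp this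
        have hva : v = (a : V) + S j (((s ^ n) c : M) : V) := by
          have := congrArg (Subtype.val) hab
          rw [pow_succ'] at this
          exact this.symm
        rw [hva]
        refine N.add_mem (hle ⟨a.2, LinearMap.mem_ker.mpr ?_⟩) (hS _ _)
        rw [← hpow, LinearMap.mem_ker.mp ha]; rfl
    exact (hker hv).2
  have hM0 : M ≠ ⊥ := by rintro rfl; exact hMN bot_le
  -- On a minimal non-zero stable `L ≤ M`, an operator `S j ≠ 0` would be surjective, which is
  -- incompatible with nilpotency.
  obtain ⟨L, ⟨hLs, hLM, hL0⟩, hLmin⟩ := exists_minimal_of_wellFoundedLT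
    (fun L : Submodule F V => (∀ i, ∀ v ∈ L, S i v ∈ L) ∧ L ≤ M ∧ L ≠ ⊥) ⟨M, hMs, le_rfl, hM0⟩
  obtain ⟨w, hw, hw0⟩ := Submodule.exists_mem_ne_zero_of_ne_bot hL0
  refine ⟨w, hw0, fun j => ?_⟩
  by_contra hj
  have hmap : L.map (S j) ≤ L := by
    rintro _ ⟨v, hv, rfl⟩; exact hLs j v hv
  have hle : L ≤ L.map (S j) := by
    refine hLmin ⟨?_, hmap.trans hLM, ?_⟩ hmap
    · rintro i _ ⟨v, hv, rfl⟩
      exact ⟨S i v, hLs i v hv, hc' j i v⟩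
    · intro h
      exact hj ((Submodule.mem_bot F).mp (h ▸ Submodule.mem_map_of_mem hw))
  have hpow : ∀ n, ∀ v ∈ L, ∃ u ∈ L, (S j ^ n) u = v := by
    intro n
    induction n with
    | zero => exact fun v hv => ⟨v, hv, rfl⟩
    | succ n ih =>
      intro v hv
      obtain ⟨u, hu, rfl⟩ := ih v hv
      obtain ⟨t, ht, rfl⟩ := hle hu
      exact ⟨t, ht, by rw [pow_succ]; rfl⟩
  obtain ⟨n, hn⟩ := hnil j
  obtain ⟨u, hu, rfl⟩ := hpow n w hw
  exact hw0 (hn u (hLM hu))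

/-- `exists_ne_zero_forall_apply_eq_zero` for operators on a possibly infinite-dimensional space,
which commute on a subspace `Z`: an eigenvector modulo a finite-dimensional stable subspace of `Z`
can be replaced by an honest eigenvector. -/
theorem exists_eigenvector_of_quotient {T : ι → Module.End F V} {μ : ι → F} {Z N : Submodule F V}
    [FiniteDimensional F N] (hc : ∀ i j, ∀ z ∈ Z, T i (T j z) = T j (T i z)) (hNZ : N ≤ Z)
    (hN : ∀ i, ∀ n ∈ N, T i n ∈ N) {v : V} (hvZ : v ∈ Z) (hv : v ∉ N)
    (hTv : ∀ i, T i v - μ i • v ∈ N) :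
    ∃ w ∈ Z, w ≠ 0 ∧ ∀ i, T i w = μ i • w := by
  let N' := N ⊔ Submodule.span F {v}
  have hN'Z : N' ≤ Z := sup_le hNZ (by simpa using hvZ)
  have hmem : ∀ i, ∀ w ∈ N', (T i - μ i • 1) w ∈ N := by
    intro i w hw
    obtain ⟨n, hn, x, hx, rfl⟩ := Submodule.mem_sup.mp hw
    obtain ⟨a, rfl⟩ := Submodule.mem_span_singleton.mp hx
    rw [map_add, map_smul]
    exact N.add_mem (N.sub_mem (hN i n hn) (N.smul_mem _ hn)) (N.smul_mem _ (hTv i))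
  have hmem' : ∀ i, ∀ w ∈ N', (T i - μ i • 1) w ∈ N' := fun i w hw =>
    (le_sup_left : N ≤ N') (hmem i w hw)
  have hcomm : ∀ i j, ∀ z ∈ Z,
      (T i - μ i • 1) ((T j - μ j • 1) z) = (T j - μ j • 1) ((T i - μ i • 1) z) := by
    intro i j z hz
    simp only [LinearMap.sub_apply, LinearMap.smul_apply, Module.End.one_apply, map_sub, map_smul,
      hc i j z hz, smul_sub, smul_comm (μ i)]
    abel
  have hvN' : v ∈ N' := (le_sup_right : _ ≤ N') (Submodule.mem_span_singleton_self v)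
  obtain ⟨w, hw0, hw⟩ := exists_ne_zero_forall_apply_eq_zero (V := N')
    (S := fun i => (T i - μ i • 1).restrict (hmem' i)) (N := N.comap N'.subtype)
    (fun i j => LinearMap.ext fun x => Subtype.ext (hcomm i j x (hN'Z x.2)))
    (fun h => hv (show (⟨v, hvN'⟩ : N') ∈ N.comap N'.subtype from h ▸ Submodule.mem_top))
    (fun i x => hmem i x x.2)
  exact ⟨w, hN'Z w.2, fun h => hw0 (Subtype.ext h), fun i =>
    sub_eq_zero.mp (congrArg Subtype.val (hw i))⟩

end LinearAlgebra

/-- Commuting operators of order dividing `ℓ - 1` on an `𝔽_ℓ`-vector space have a common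
eigenvector in every non-zero stable subspace. -/
theorem exists_common_eigenvector {ℓ : ℕ} [Fact ℓ.Prime] {V ι : Type*} [AddCommGroup V]
    [Module (ZMod ℓ) V] [FiniteDimensional (ZMod ℓ) V] {D : ι → Module.End (ZMod ℓ) V}
    (hc : ∀ i j, Commute (D i) (D j)) (hD : ∀ i, D i ^ (ℓ - 1) = 1)
    {S : Submodule (ZMod ℓ) V} (hS : ∀ i, ∀ v ∈ S, D i v ∈ S) (hS0 : S ≠ ⊥) :
    ∃ v ∈ S, v ≠ 0 ∧ ∀ i, ∃ a : ZMod ℓ, D i v = a • v := by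
  have hc' : ∀ i j v, D i (D j v) = D j (D i v) := fun i j v =>
    congrArg (fun f : Module.End (ZMod ℓ) V => f v) (hc i j)
  obtain ⟨L, ⟨hLs, hLS, hL0⟩, hLmin⟩ := exists_minimal_of_wellFoundedLT
    (fun L : Submodule (ZMod ℓ) V => (∀ i, ∀ v ∈ L, D i v ∈ L) ∧ L ≤ S ∧ L ≠ ⊥)
    ⟨S, hS, le_rfl, hS0⟩
  obtain ⟨w, hw, hw0⟩ := Submodule.exists_mem_ne_zero_of_ne_bot hL0
  refine ⟨w, hLS hw, hw0, fun i => ?_⟩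
  obtain ⟨a, u, hu, hu0, hua⟩ : ∃ a : ZMod ℓ, ∃ u ∈ L, u ≠ 0 ∧ D i u = a • u := by
    let d : Module.End (ZMod ℓ) L := (D i).restrict (hLs i)
    have hpow := coe_restrict_pow (hLs i)
    have hd : d ^ ℓ = d := by
      have h1 : d ^ (ℓ - 1) = 1 := by
        ext x; rw [hpow, hD]; rfl
      have := (Fact.out : ℓ.Prime).one_le
      calc d ^ ℓ = d ^ (ℓ - 1) * d := by rw [← pow_succ, Nat.sub_add_cancel this]
        _ = d := by rw [h1, one_mul]
    -- The minimal polynomial divides `X ^ ℓ - X`, so it splits over `𝔽_ℓ`.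
    have hdvd : minpoly (ZMod ℓ) d ∣ (Polynomial.X ^ ℓ - Polynomial.X : Polynomial (ZMod ℓ)) :=
      minpoly.dvd _ _ (by simp [hd])
    have : Nontrivial L := ⟨⟨w, hw⟩, 0, fun h => hw0 (congrArg Subtype.val h)⟩
    have hspl : (minpoly (ZMod ℓ) d).Splits := by
      refine Polynomial.Splits.of_dvd ?_ ?_ hdvd
      · simpa using FiniteField.splits_X_pow_card_sub_X (p := ℓ) (K := ZMod ℓ)
      · exact FiniteField.X_pow_card_sub_X_ne_zero _ (Fact.out : ℓ.Prime).one_lt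
    obtain ⟨a, ha⟩ := hspl.exists_eval_eq_zero
      (minpoly.degree_pos (Algebra.IsIntegral.isIntegral d)).ne'
    obtain ⟨u, hu⟩ := (Module.End.hasEigenvalue_of_isRoot ha).exists_hasEigenvector
    exact ⟨a, u, u.2, fun h => hu.2 (Subtype.ext h), congrArg Subtype.val hu.apply_eq_smul⟩
  -- The `a`-eigenspace of `D i` in `L` is stable under the family, hence is all of `L`.
  have hle : L ≤ L ⊓ LinearMap.ker (D i - a • 1) := by
    refine hLmin ⟨?_, inf_le_left.trans hLS, ?_⟩ inf_le_left
    · rintro j v ⟨hv, hv'⟩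
      refine ⟨hLs j v hv, ?_⟩
      have : D i v = a • v := by simpa [sub_eq_zero] using hv'
      simp [hc' i j, this]
    · intro h
      refine hu0 ((Submodule.mem_bot (ZMod ℓ)).mp (h ▸ ⟨hu, ?_⟩))
      simp [hua]
  exact ⟨a, by simpa [sub_eq_zero] using (hle hw).2⟩

/-! ### Matrices in congruence subgroups -/

section Matrices

variable {R : Type} [CommRing R] {Γ : Subgroup (Matrix.SpecialLinearGroup (Fin 2) R)}

theorem mat_mul (g h : Γ) : mat (g * h) = mat g * mat h := rfl

theorem mat_inv_mul (g : Γ) : mat g⁻¹ * mat g = 1 := by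
  rw [← mat_mul, inv_mul_cancel]; rfl

theorem mat_mul_inv (g : Γ) : mat g * mat g⁻¹ = 1 := by
  rw [← mat_mul, mul_inv_cancel]; rfl

theorem det_mat (g : Γ) : (mat g).det = 1 := Matrix.SpecialLinearGroup.det_coe _

theorem mul_left_cancel_of_det_ne_zero [IsDomain R] {δ M N : Matrix (Fin 2) (Fin 2) R}
    (hδ : δ.det ≠ 0) (h : δ * M = δ * N) : M = N := by
  have := congrArg (δ.adjugate * ·) h
  simp only [← Matrix.mul_assoc, Matrix.adjugate_mul, Matrix.smul_mul, Matrix.one_mul] at this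
  exact smul_right_injective _ hδ this

theorem tildeMat_mul (α β : R) : tildeMat α * tildeMat β = tildeMat (α * β) := by
  simp [tildeMat]

theorem tildeMat_comm (α β : R) : tildeMat α * tildeMat β = tildeMat β * tildeMat α := by
  rw [tildeMat_mul, tildeMat_mul, mul_comm]

/-- The elementary matrix `(1 t; 0 1)`. -/
def upper (t : R) : Matrix.SpecialLinearGroup (Fin 2) R := ⟨!![1, t; 0, 1], by simp⟩

/-- The elementary matrix `(1 0; t 1)`. -/
def lower (t : R) : Matrix.SpecialLinearGroup (Fin 2) R := ⟨!![1, 0; t, 1], by simp⟩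

theorem upper_mul_apply_zero_one (t : R) (M : Matrix.SpecialLinearGroup (Fin 2) R) :
    (upper t * M) 0 1 = M 0 1 + t * M 1 1 := by
  rw [Matrix.SpecialLinearGroup.coe_mul, Matrix.mul_apply, Fin.sum_univ_two]
  simp [upper]

theorem lower_mul_apply_zero_one (t : R) (M : Matrix.SpecialLinearGroup (Fin 2) R) :
    (lower t * M) 0 1 = M 0 1 := by
  rw [Matrix.SpecialLinearGroup.coe_mul, Matrix.mul_apply, Fin.sum_univ_two]
  simp [lower]

theorem lower_mul_apply_one_one (t : R) (M : Matrix.SpecialLinearGroup (Fin 2) R) :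
    (lower t * M) 1 1 = M 1 1 + t * M 0 1 := by
  rw [Matrix.SpecialLinearGroup.coe_mul, Matrix.mul_apply, Fin.sum_univ_two]
  simp [lower, add_comm]

theorem upper_mem_Gamma1 (𝔟 : Ideal R) (t : R) : upper t ∈ Gamma1 𝔟 := by
  constructor <;> simp [upper]

theorem lower_mem_Gamma1 {𝔟 : Ideal R} {t : R} (ht : t ∈ 𝔟) : lower t ∈ Gamma1 𝔟 := by
  constructor <;> simp [lower, ht]

theorem Gamma1_mono {𝔟 𝔠 : Ideal R} (h : 𝔠 ≤ 𝔟) : Gamma1 𝔠 ≤ Gamma1 𝔟 :=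
  fun _ hg => ⟨h hg.1, h hg.2⟩

theorem mul_tildeMat (M : Matrix (Fin 2) (Fin 2) R) (α : R) :
    M * tildeMat α = !![M 0 0 * α, M 0 1; M 1 0 * α, M 1 1] := by
  ext i j
  fin_cases i <;> fin_cases j <;> simp [tildeMat, Matrix.mul_apply, Fin.sum_univ_two]

theorem tildeMat_mul_eq (M : Matrix (Fin 2) (Fin 2) R) (α : R) :
    tildeMat α * M = !![α * M 0 0, α * M 0 1; M 1 0, M 1 1] := by
  ext i j
  fin_cases i <;> fin_cases j <;> simp [tildeMat, Matrix.mul_apply, Fin.sum_univ_two]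

theorem det_eq (g : Γ) : mat g 0 0 * mat g 1 1 - mat g 0 1 * mat g 1 0 = 1 := by
  rw [← Matrix.det_fin_two, det_mat]

/-- The conjugate `α̃⁻¹ g α̃` is integral, and in `Γ₁(𝔟)`, if `α` divides the upper right entry
of `g`. -/
theorem exists_mul_tildeMat_of_dvd {𝔟 : Ideal R} {α : R} {g : Gamma1 𝔟}
    (h : α ∣ mat g 0 1) : ∃ k : Gamma1 𝔟, mat g * tildeMat α = tildeMat α * mat k := by
  obtain ⟨b, hb⟩ := h
  have hd := det_eq g
  refine ⟨⟨⟨!![mat g 0 0, b; α * mat g 1 0, mat g 1 1], ?_⟩, ?_, ?_⟩, ?_⟩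
  · rw [Matrix.det_fin_two_of]
    rw [hb] at hd
    linear_combination hd
  · simpa using 𝔟.mul_mem_left _ g.2.1
  · simpa using g.2.2
  · rw [mul_tildeMat, tildeMat_mul_eq]
    change _ = !![α * mat g 0 0, α * b; α * mat g 1 0, mat g 1 1]
    rw [hb, mul_comm (mat g 0 0), mul_comm (mat g 1 0)]

/-- The conjugate `α̃ g α̃⁻¹` is in `Γ₁(𝔟)` if the lower left entry of `g` is in `α𝔟`. -/
theorem exists_tildeMat_mul_of_mem {𝔟 : Ideal R} {α : R} {g : Gamma1 𝔟}
    (h : mat g 1 0 ∈ Ideal.span {α} * 𝔟) :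
    ∃ k : Gamma1 𝔟, tildeMat α * mat g = mat k * tildeMat α := by
  obtain ⟨c, hc, hcα⟩ := Ideal.mem_span_singleton_mul.mp h
  have hd := det_eq g
  refine ⟨⟨⟨!![mat g 0 0, α * mat g 0 1; c, mat g 1 1], ?_⟩, ?_, ?_⟩, ?_⟩
  · rw [Matrix.det_fin_two_of]
    rw [← hcα] at hd
    linear_combination hd
  · simpa using hc
  · simpa using g.2.2
  · rw [mul_tildeMat, tildeMat_mul_eq]
    change _ = !![mat g 0 0 * α, α * mat g 0 1; c * α, mat g 1 1]
    rw [← hcα, mul_comm (mat g 0 0), mul_comm c]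

theorem mem_upperSubgroup_iff {𝔟 : Ideal R} {α : R} {g : Gamma1 𝔟} :
    g ∈ upperSubgroup (Gamma1 𝔟) α ↔ α ∣ mat g 0 1 := by
  refine ⟨?_, exists_mul_tildeMat_of_dvd⟩
  rintro ⟨h, hh⟩
  rw [mul_tildeMat, tildeMat_mul_eq] at hh
  exact ⟨mat h 0 1, by simpa using congrFun (congrFun hh 0) 1⟩

/-- If `π` divides `𝔠` only when it divides `𝔟`, then every element of `Γ₁(𝔟)` becomes lower
triangular modulo `π` after left multiplication by an element of the possibly deeper group `Γ₁(𝔠)`.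
This is the only approximation property that the comparison of the cosets at different levels and
the commutation of the Hecke operators need. -/
theorem exists_mem_Gamma1_dvd [IsDedekindDomain R] {𝔟 𝔠 : Ideal R} {π : R}
    (hπ : Prime π) (h𝔠 : 𝔠 ≤ Ideal.span {π} → 𝔟 ≤ Ideal.span {π})
    {g : Matrix.SpecialLinearGroup (Fin 2) R} (hg : g ∈ Gamma1 𝔟) :
    ∃ h ∈ Gamma1 𝔠, π ∣ (h⁻¹ * g) 0 1 := by
  have hd : g 0 0 * g 1 1 - g 0 1 * g 1 0 = 1 := by
    rw [← Matrix.det_fin_two, g.det_coe]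
  -- A lower elementary matrix in `Γ₁(𝔠)` makes the lower right entry prime to `π`; then an upper
  -- elementary matrix clears the upper right entry modulo `π`.
  obtain ⟨s, hs, hsπ⟩ : ∃ s ∈ 𝔠, ¬ π ∣ g 1 1 + s * g 0 1 := by
    by_cases hdπ : π ∣ g 1 1
    · have h1 : ¬ 𝔟 ≤ Ideal.span {π} := fun h => hπ.not_dvd_one <| by
        have := (dvd_sub_right hdπ).mp (Ideal.mem_span_singleton.mp (h hg.2))
        exact this
      obtain ⟨s, hs, hsπ⟩ := SetLike.not_le_iff_exists.mp (mt h𝔠 h1)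
      refine ⟨s, hs, fun h => ?_⟩
      rw [dvd_add_right hdπ] at h
      rcases hπ.dvd_or_dvd h with h | h
      · exact hsπ (Ideal.mem_span_singleton.mpr h)
      · exact hπ.not_dvd_one (hd ▸ dvd_sub (hdπ.mul_left _) (h.mul_right _))
    · exact ⟨0, 𝔠.zero_mem, by simpa using hdπ⟩
  have hmax : (Ideal.span {π}).IsMaximal :=
    ((Ideal.span_singleton_prime hπ.ne_zero).mpr hπ).isMaximal (by simpa using hπ.ne_zero)
  obtain ⟨y, z, hz, hyz⟩ := hmax.exists_inv (mt Ideal.mem_span_singleton.mp hsπ)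
  obtain ⟨w, rfl⟩ := Ideal.mem_span_singleton.mp hz
  refine ⟨(upper (-(g 0 1 * y)) * lower s)⁻¹, inv_mem (mul_mem (upper_mem_Gamma1 _ _)
    (lower_mem_Gamma1 hs)), w * g 0 1, ?_⟩
  have he : (upper (-(g 0 1 * y)) * lower s * g) 0 1 =
      g 0 1 - g 0 1 * y * (g 1 1 + s * g 0 1) := by
    rw [mul_assoc, upper_mul_apply_zero_one, lower_mul_apply_one_one, lower_mul_apply_zero_one]
    ring
  rw [inv_inv, he]
  linear_combination (-g 0 1) * hyz

end Matrices

/-! ### Transversals of Hecke cosets -/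

section Cosets

variable {R : Type} [CommRing R] {Γ : Subgroup (Matrix.SpecialLinearGroup (Fin 2) R)} {α : R}

theorem exists_cosetRep_mul (a : Γ) :
    ∃ (x : HeckeIndex Γ α) (k : Γ), mat a * tildeMat α = cosetRep x * mat k := by
  obtain ⟨⟨q, p, hp⟩, hq⟩ := QuotientGroup.mk_out_eq_mul (upperSubgroup Γ α) a
  refine ⟨(a : HeckeIndex Γ α), p⁻¹, ?_⟩
  rw [cosetRep, hq]
  change _ = mat a * mat q * tildeMat α * mat p⁻¹
  rw [Matrix.mul_assoc (mat a), hp, Matrix.mul_assoc (mat a), Matrix.mul_assoc, mat_mul_inv,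
    Matrix.mul_one]

theorem eq_of_cosetRep_mul_eq {x y : HeckeIndex Γ α} {k : Γ}
    (h : cosetRep x * mat k = cosetRep y) : x = y := by
  rw [← QuotientGroup.out_eq' x, ← QuotientGroup.out_eq' y]
  refine QuotientGroup.eq.mpr ⟨k, ?_⟩
  rw [mat_mul, Matrix.mul_assoc]
  change _ * cosetRep y = _
  rw [← h, cosetRep, Matrix.mul_assoc, ← Matrix.mul_assoc, mat_inv_mul, Matrix.one_mul]

variable {k E : Type} [CommRing k] [AddCommGroup E] [Module k E] {𝔫 : Ideal R}
  (ρ : Representation k (GL (Fin 2) (R ⧸ 𝔫))ᵐᵒᵖ E)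

theorem isUnit_mk_det_adjugate {m : Matrix (Fin 2) (Fin 2) R}
    (hm : IsUnit (Ideal.Quotient.mk 𝔫 m.det)) : IsUnit (Ideal.Quotient.mk 𝔫 m.adjugate.det) := by
  rw [Matrix.det_adjugate]
  simpa using hm

/-- Right multiplication by `m^ι = adj m`. -/
def adjMul (m : Matrix (Fin 2) (Fin 2) R) (hm : IsUnit (Ideal.Quotient.mk 𝔫 m.det)) : E →ₗ[k] E :=
  rightMul ρ m.adjugate (isUnit_mk_det_adjugate hm)

theorem isUnit_mk_det_mul {m n : Matrix (Fin 2) (Fin 2) R}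
    (hm : IsUnit (Ideal.Quotient.mk 𝔫 m.det)) (hn : IsUnit (Ideal.Quotient.mk 𝔫 n.det)) :
    IsUnit (Ideal.Quotient.mk 𝔫 (m * n).det) := by
  rw [Matrix.det_mul, map_mul]
  exact hm.mul hn

theorem isUnit_mk_det_mat (g : Γ) : IsUnit (Ideal.Quotient.mk 𝔫 (mat g).det) := by
  rw [det_mat]; simp

theorem adjMul_mul {m n : Matrix (Fin 2) (Fin 2) R} (hm hn hmn) (v : E) :
    adjMul ρ (m * n) hmn v = adjMul ρ m hm (adjMul ρ n hn v) := by
  unfold adjMul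
  rw [← rightMul_mul ρ _ _ _ _ (by
    rw [← Matrix.adjugate_mul_distrib]; exact isUnit_mk_det_adjugate hmn)]
  congr 1
  simp only [Matrix.adjugate_mul_distrib]

theorem adjMul_mat (g : Γ) (v : E) :
    adjMul ρ (mat g) (isUnit_mk_det_mat g) v = leftAction ρ g v :=
  (leftAction_apply ρ _ _ _).symm

/-- Independence of the transversal: if `δ₁` and `δ₂` represent the same cosets
`δ Γ`, then the sums over the transversals that define the Hecke operator on cocycles differ by an
explicit coboundary. The sums are stated for arbitrary families of matrices, so that this covers
changes of the level, products of two Hecke operators and multiples of `α` by a unit. Only the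
elements of `δ₂` are required to represent distinct cosets. -/
theorem sum_change_transversal [IsDomain R] {Y₁ Y₂ : Type} [Fintype Y₁] [Fintype Y₂] {c : Γ → E}
    (hc : c ∈ groupCohomology.cocycles₁ (coeff Γ ρ))
    {δ₁ : Y₁ → Matrix (Fin 2) (Fin 2) R} {δ₂ : Y₂ → Matrix (Fin 2) (Fin 2) R}
    (hu₁ : ∀ y, IsUnit (Ideal.Quotient.mk 𝔫 (δ₁ y).det))
    (hu₂ : ∀ y, IsUnit (Ideal.Quotient.mk 𝔫 (δ₂ y).det)) (hdet : ∀ y, (δ₂ y).det ≠ 0)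
    (hinj : ∀ y y' (k : Γ), δ₂ y * mat k = δ₂ y' → y = y')
    {j : Y₁ → Y₂} (hj : Function.Bijective j) {k : Y₁ → Γ} (hk : ∀ y, δ₂ (j y) = δ₁ y * mat (k y))
    (g : Γ) (σ₁ : Equiv.Perm Y₁) (σ₂ : Y₂ → Y₂) {h₁ : Y₁ → Γ} {h₂ : Y₂ → Γ}
    (H₁ : ∀ y, mat g * δ₁ (σ₁ y) = δ₁ y * mat (h₁ y))
    (H₂ : ∀ y, mat g * δ₂ (σ₂ y) = δ₂ y * mat (h₂ y)) :
    ∑ y, adjMul ρ (δ₂ y) (hu₂ y) (c (h₂ y)) = ∑ y, adjMul ρ (δ₁ y) (hu₁ y) (c (h₁ y)) +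
      (leftAction ρ g (∑ y, adjMul ρ (δ₁ y) (hu₁ y) (c (k y))) -
        ∑ y, adjMul ρ (δ₁ y) (hu₁ y) (c (k y))) := by
  rw [groupCohomology.mem_cocycles₁_iff] at hc
  change ∀ g h : Γ, c (g * h) = leftAction ρ g (c h) + c g at hc
  -- `g` permutes the cosets in the same way for both transversals, and the elements of `Γ` that
  -- occur are related by `h₂ (j y) = (k y)⁻¹ h₁ y k (σ₁ y)`.
  have key : ∀ y, mat g * δ₂ (j (σ₁ y)) = δ₂ (j y) * mat ((k y)⁻¹ * h₁ y * k (σ₁ y)) := by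
    intro y
    have hk' : δ₂ (j y) * mat (k y)⁻¹ = δ₁ y := by
      rw [hk, Matrix.mul_assoc, mat_mul_inv, Matrix.mul_one]
    rw [hk, ← Matrix.mul_assoc, H₁, ← hk', mat_mul, mat_mul]
    simp only [Matrix.mul_assoc]
  have hσ : ∀ y, σ₂ (j y) = j (σ₁ y) := by
    intro y
    refine hinj _ _ ((h₂ (j y))⁻¹ * ((k y)⁻¹ * h₁ y * k (σ₁ y))) ?_
    have hg : mat g⁻¹ * mat g = 1 := mat_inv_mul g
    have hk2 : mat g * δ₂ (σ₂ (j y)) * mat (h₂ (j y))⁻¹ = δ₂ (j y) := by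
      rw [H₂, Matrix.mul_assoc, mat_mul_inv, Matrix.mul_one]
    calc δ₂ (σ₂ (j y)) * mat ((h₂ (j y))⁻¹ * ((k y)⁻¹ * h₁ y * k (σ₁ y)))
        = mat g⁻¹ * mat g * δ₂ (σ₂ (j y)) * (mat (h₂ (j y))⁻¹ *
            mat ((k y)⁻¹ * h₁ y * k (σ₁ y))) := by
          rw [hg, Matrix.one_mul, ← mat_mul]
      _ = mat g⁻¹ * (mat g * δ₂ (σ₂ (j y)) * mat (h₂ (j y))⁻¹ *
            mat ((k y)⁻¹ * h₁ y * k (σ₁ y))) := by simp only [Matrix.mul_assoc]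
      _ = mat g⁻¹ * (mat g * δ₂ (j (σ₁ y))) := by rw [hk2, key]
      _ = δ₂ (j (σ₁ y)) := by rw [← Matrix.mul_assoc, hg, Matrix.one_mul]
  have hh : ∀ y, h₂ (j y) = (k y)⁻¹ * h₁ y * k (σ₁ y) := by
    intro y
    refine Subtype.ext (Subtype.ext (mul_left_cancel_of_det_ne_zero (hdet (j y)) ?_))
    change δ₂ (j y) * mat (h₂ (j y)) = δ₂ (j y) * mat ((k y)⁻¹ * h₁ y * k (σ₁ y))
    rw [← H₂, ← key, hσ]
  have hc1 : c 1 = 0 := by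
    simpa using hc 1 1
  have hcinv : ∀ g, c g⁻¹ = - leftAction ρ g⁻¹ (c g) := by
    intro g
    have := hc g⁻¹ g
    rw [inv_mul_cancel, hc1] at this
    exact eq_neg_of_add_eq_zero_right this.symm
  have hmove : ∀ y v, adjMul ρ (δ₁ y) (hu₁ y) (leftAction ρ (h₁ y) v) =
      leftAction ρ g (adjMul ρ (δ₁ (σ₁ y)) (hu₁ (σ₁ y)) v) := by
    intro y v
    rw [← adjMul_mat, ← adjMul_mat, ← adjMul_mul ρ _ _ (isUnit_mk_det_mul (hu₁ y)
      (isUnit_mk_det_mat _)), ← adjMul_mul ρ _ _ (isUnit_mk_det_mul (isUnit_mk_det_mat _)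
      (hu₁ (σ₁ y)))]
    simp only [H₁]
  have hterm : ∀ y, adjMul ρ (δ₂ (j y)) (hu₂ (j y)) (c (h₂ (j y))) =
      adjMul ρ (δ₁ y) (hu₁ y) (c (h₁ y)) +
        (leftAction ρ g (adjMul ρ (δ₁ (σ₁ y)) (hu₁ (σ₁ y)) (c (k (σ₁ y)))) -
          adjMul ρ (δ₁ y) (hu₁ y) (c (k y))) := by
    intro y
    have e1 : c (h₂ (j y)) = leftAction ρ ((k y)⁻¹ : Γ)
        (leftAction ρ (h₁ y) (c (k (σ₁ y))) + c (h₁ y) - c (k y)) := by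
      rw [hh, mul_assoc, hc, hc, hcinv, map_sub, sub_eq_add_neg]
      rfl
    have e2 : ∀ v, adjMul ρ (δ₂ (j y)) (hu₂ (j y)) v =
        adjMul ρ (δ₁ y) (hu₁ y) (leftAction ρ (k y) v) := by
      intro v
      rw [← adjMul_mat, ← adjMul_mul ρ _ _ (isUnit_mk_det_mul (hu₁ y) (isUnit_mk_det_mat _))]
      simp only [hk]
    have hinv' : ∀ v : E, leftAction ρ (k y) (leftAction ρ ((k y)⁻¹ : Γ) v) = v := by
      intro v
      simp
    rw [e1, e2, hinv', map_sub, map_add, hmove]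
    abel
  rw [← Equiv.sum_comp (Equiv.ofBijective j hj)]
  simp only [Equiv.ofBijective_apply, hterm, Finset.sum_add_distrib, Finset.sum_sub_distrib,
    map_sum]
  congr 2
  exact Equiv.sum_comp σ₁ (fun y => leftAction ρ g (adjMul ρ (δ₁ y) (hu₁ y) (c (k y))))

end Cosets

/-! ### Change of level -/

section LevelChange

variable {R : Type} [CommRing R] [IsDedekindDomain R] {𝔟 𝔠 : Ideal R} {π : R}

/-- The cosets in `Γ π̃ Γ / Γ` for `Γ = Γ₁(𝔟)` can be represented by matrices that represent those
for the smaller group `Γ₁(𝔠)`, if `π` divides both or neither of `𝔟` and `𝔠`. -/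
theorem exists_bijective_heckeIndex [Finite (HeckeIndex (Gamma1 𝔟) π)] (hπ : Prime π)
    (hle : 𝔠 ≤ 𝔟) (h𝔠 : 𝔠 ≤ Ideal.span {π} → 𝔟 ≤ Ideal.span {π}) :
    (∀ (y y' : HeckeIndex (Gamma1 𝔠) π) (k : Gamma1 𝔟),
      cosetRep y * mat k = cosetRep y' → y = y') ∧
    ∃ (j : HeckeIndex (Gamma1 𝔟) π → HeckeIndex (Gamma1 𝔠) π)
      (k : HeckeIndex (Gamma1 𝔟) π → Gamma1 𝔟), Function.Bijective j ∧
        ∀ x, cosetRep (j x) = cosetRep x * mat (k x) := by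
  have hinj : ∀ (y y' : HeckeIndex (Gamma1 𝔠) π) (k : Gamma1 𝔟),
      cosetRep y * mat k = cosetRep y' → y = y' := by
    intro y y' k h
    rw [← QuotientGroup.out_eq' y, ← QuotientGroup.out_eq' y']
    refine QuotientGroup.eq.mpr (mem_upperSubgroup_iff.mpr ?_)
    have h2 : mat (y.out⁻¹ * y'.out) * tildeMat π = tildeMat π * mat k := by
      rw [mat_mul, Matrix.mul_assoc]
      change _ * cosetRep y' = _
      rw [← h, cosetRep, Matrix.mul_assoc, ← Matrix.mul_assoc, mat_inv_mul, Matrix.one_mul]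
    rw [mul_tildeMat, tildeMat_mul_eq] at h2
    exact ⟨mat k 0 1, by simpa using congrFun (congrFun h2 0) 1⟩
  refine ⟨hinj, ?_⟩
  have hex : ∀ x : HeckeIndex (Gamma1 𝔟) π, ∃ (y : HeckeIndex (Gamma1 𝔠) π) (k : Gamma1 𝔟),
      cosetRep y = cosetRep x * mat k := by
    intro x
    obtain ⟨h, hh, hd⟩ := exists_mem_Gamma1_dvd hπ h𝔠 x.out.2
    obtain ⟨q, hq⟩ := exists_mul_tildeMat_of_dvd (𝔟 := 𝔟)
      (g := ⟨h⁻¹ * x.out, mul_mem (inv_mem (Gamma1_mono hle hh)) x.out.2⟩) hd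
    obtain ⟨y, k, hk⟩ := exists_cosetRep_mul (α := π) (⟨h, hh⟩ : Gamma1 𝔠)
    refine ⟨y, (Subgroup.inclusion (Gamma1_mono hle) k * q)⁻¹, ?_⟩
    have hx : cosetRep x = cosetRep y * mat (Subgroup.inclusion (Gamma1_mono hle) k * q) := by
      change mat x.out * _ = cosetRep y * (mat k * mat q)
      rw [← Matrix.mul_assoc, ← hk, Matrix.mul_assoc, ← hq, ← Matrix.mul_assoc]
      congr 1
      change ((x.out : Matrix.SpecialLinearGroup (Fin 2) R) : Matrix (Fin 2) (Fin 2) R) =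
        ((h * (h⁻¹ * x.out) : Matrix.SpecialLinearGroup (Fin 2) R) : Matrix (Fin 2) (Fin 2) R)
      rw [mul_inv_cancel_left]
    rw [hx, Matrix.mul_assoc, mat_mul_inv, Matrix.mul_one]
  choose j k hjk using hex
  refine ⟨j, k, ⟨fun x x' h => ?_, fun y => ?_⟩, hjk⟩
  · refine eq_of_cosetRep_mul_eq (k := k x * (k x')⁻¹) ?_
    rw [mat_mul, ← Matrix.mul_assoc, ← hjk, h, hjk, Matrix.mul_assoc, mat_mul_inv, Matrix.mul_one]
  · obtain ⟨x, q, hq⟩ := exists_cosetRep_mul (α := π)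
      (Subgroup.inclusion (Gamma1_mono hle) y.out)
    refine ⟨x, hinj _ _ ((k x)⁻¹ * q) ?_⟩
    rw [hjk, mat_mul, Matrix.mul_assoc, ← Matrix.mul_assoc (mat (k x)), mat_mul_inv,
      Matrix.one_mul, ← hq]
    rfl

end LevelChange

/-! ### Commutation of the Hecke operators with trivial coefficients -/

section Commute

variable {R : Type} [CommRing R] [IsDedekindDomain R] {𝔟 𝔫 : Ideal R} {α β : R}
  {k : Type} [CommRing k]

variable (k 𝔫) in
/-- The trivial right `GL₂(R/𝔫)`-module. -/
abbrev trivialRep : Representation k (GL (Fin 2) (R ⧸ 𝔫))ᵐᵒᵖ k := Representation.trivial k _ k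

omit [IsDedekindDomain R] in
theorem heckeFun_trivial (hα : IsUnit (Ideal.Quotient.mk 𝔫 α)) (c : Gamma1 𝔟 → k) (g : Gamma1 𝔟) :
    heckeFun (trivialRep 𝔫 k) hα c g = ∑ᶠ x : HeckeIndex (Gamma1 𝔟) α, c (transfer g x) := rfl

/-- `sum_change_transversal` for trivial coefficients. -/
theorem sum_change_transversal_trivial {Γ : Subgroup (Matrix.SpecialLinearGroup (Fin 2) R)}
    {Y₁ Y₂ : Type} [Fintype Y₁] [Fintype Y₂]
    {c : Γ → k} (hc : c ∈ groupCohomology.cocycles₁ (coeff Γ (trivialRep 𝔫 k)))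
    {δ₁ : Y₁ → Matrix (Fin 2) (Fin 2) R} {δ₂ : Y₂ → Matrix (Fin 2) (Fin 2) R}
    (hu₁ : ∀ y, IsUnit (Ideal.Quotient.mk 𝔫 (δ₁ y).det))
    (hu₂ : ∀ y, IsUnit (Ideal.Quotient.mk 𝔫 (δ₂ y).det)) (hdet : ∀ y, (δ₂ y).det ≠ 0)
    (hinj : ∀ y y' (k : Γ), δ₂ y * mat k = δ₂ y' → y = y')
    {j : Y₁ → Y₂} (hj : Function.Bijective j) {k : Y₁ → Γ} (hk : ∀ y, δ₂ (j y) = δ₁ y * mat (k y))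
    (g : Γ) (σ₁ : Equiv.Perm Y₁) (σ₂ : Y₂ → Y₂) {h₁ : Y₁ → Γ} {h₂ : Y₂ → Γ}
    (H₁ : ∀ y, mat g * δ₁ (σ₁ y) = δ₁ y * mat (h₁ y))
    (H₂ : ∀ y, mat g * δ₂ (σ₂ y) = δ₂ y * mat (h₂ y)) :
    ∑ y, c (h₂ y) = ∑ y, c (h₁ y) := by
  have := sum_change_transversal _ hc hu₁ hu₂ hdet hinj hj hk g σ₁ σ₂ H₁ H₂
  change ∑ y, c (h₂ y) = ∑ y, c (h₁ y) + (∑ y, c (k y) - ∑ y, c (k y)) at this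
  rwa [sub_self, add_zero] at this

/-- The action of `g` on the pairs of cosets that index the product of two Hecke operators. -/
def pairPerm (g : Gamma1 𝔟) :
    Equiv.Perm (HeckeIndex (Gamma1 𝔟) α × HeckeIndex (Gamma1 𝔟) β) where
  toFun p := (g⁻¹ • p.1, (transfer g p.1)⁻¹ • p.2)
  invFun p := (g • p.1, transfer g (g • p.1) • p.2)
  left_inv p := by simp
  right_inv p := by simp

omit [IsDedekindDomain R] in
theorem pairPerm_spec (g : Gamma1 𝔟) (p : HeckeIndex (Gamma1 𝔟) α × HeckeIndex (Gamma1 𝔟) β) :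
    mat g * (cosetRep (pairPerm g p).1 * cosetRep (pairPerm g p).2) =
      cosetRep p.1 * cosetRep p.2 * mat (transfer (transfer g p.1) p.2) := by
  have h1 := transfer_spec g p.1
  have h2 := transfer_spec (transfer g p.1) p.2
  change mat g * (cosetRep (g⁻¹ • p.1) * cosetRep ((transfer g p.1)⁻¹ • p.2)) = _
  rw [← Matrix.mul_assoc, h1, Matrix.mul_assoc, h2, Matrix.mul_assoc]

/-- For `α ∤ β` the products `γ_x γ_y` lie in distinct cosets. -/
theorem pair_injective (hα : Prime α) (hαβ : ¬ α ∣ β)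
    (p p' : HeckeIndex (Gamma1 𝔟) α × HeckeIndex (Gamma1 𝔟) β) (k : Gamma1 𝔟)
    (h : cosetRep p.1 * cosetRep p.2 * mat k = cosetRep p'.1 * cosetRep p'.2) : p = p' := by
  obtain ⟨x, y⟩ := p
  obtain ⟨x', y'⟩ := p'
  dsimp only at h
  have hx : x = x' := by
    rw [← QuotientGroup.out_eq' x, ← QuotientGroup.out_eq' x']
    refine QuotientGroup.eq.mpr (mem_upperSubgroup_iff.mpr ?_)
    have h2 : mat (x.out⁻¹ * x'.out) * tildeMat α * cosetRep y' =
        tildeMat α * (cosetRep y * mat k) := by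
      rw [mat_mul, Matrix.mul_assoc (mat x.out⁻¹)]
      change _ * cosetRep x' * _ = _
      rw [Matrix.mul_assoc, ← h, cosetRep]
      simp only [← Matrix.mul_assoc]
      rw [mat_inv_mul, Matrix.one_mul]
    have h3 := congrArg (· * (cosetRep y').adjugate) h2
    simp only [Matrix.mul_assoc _ (cosetRep y'), Matrix.mul_adjugate, det_cosetRep] at h3
    rw [Matrix.mul_smul, Matrix.mul_one, mul_tildeMat, Matrix.mul_assoc, tildeMat_mul_eq] at h3
    have h4 := congrFun (congrFun h3 0) 1
    simp only [Matrix.smul_apply, Matrix.of_apply, Matrix.cons_val', Matrix.cons_val_one,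
      Matrix.cons_val_zero, smul_eq_mul, Matrix.cons_val_fin_one] at h4
    exact (hα.dvd_or_dvd ⟨_, h4⟩).resolve_left hαβ
  subst hx
  refine Prod.ext rfl (eq_of_cosetRep_mul_eq (k := k) ?_)
  rw [Matrix.mul_assoc] at h
  exact mul_left_cancel_of_det_ne_zero (by rw [det_cosetRep]; exact hα.ne_zero) h

/-- The cosets of the products `γ_x γ_y` for `(α, β)` are among those for `(β, α)`. After a
modification of `γ_y` in its coset, `y` is represented by an element that `α̃` conjugates into `Γ`;
then `α̃` and `β̃` can be interchanged. -/
theorem exists_pair_swap (hβ : Prime β) (hαβ : ¬ β ∣ α)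
    (p : HeckeIndex (Gamma1 𝔟) α × HeckeIndex (Gamma1 𝔟) β) :
    ∃ (q : HeckeIndex (Gamma1 𝔟) β × HeckeIndex (Gamma1 𝔟) α) (k : Gamma1 𝔟),
      cosetRep q.1 * cosetRep q.2 = cosetRep p.1 * cosetRep p.2 * mat k := by
  obtain ⟨x, y⟩ := p
  have h𝔠 : Ideal.span {α} * 𝔟 ≤ Ideal.span {β} → 𝔟 ≤ Ideal.span {β} := by
    intro h b hb
    have := h (Ideal.mul_mem_mul (Ideal.mem_span_singleton_self α) hb)
    rw [Ideal.mem_span_singleton] at this ⊢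
    exact (hβ.dvd_or_dvd this).resolve_left hαβ
  obtain ⟨h, q, hy, hh, hq⟩ : ∃ h q : Gamma1 𝔟, y.out = h * q ∧
      mat h 1 0 ∈ Ideal.span {α} * 𝔟 ∧ β ∣ mat q 0 1 := by
    obtain ⟨h, hh, hd⟩ := exists_mem_Gamma1_dvd hβ h𝔠 y.out.2
    have hle : Ideal.span {α} * 𝔟 ≤ 𝔟 := Ideal.mul_le_right
    have hhb : h ∈ Gamma1 𝔟 := Gamma1_mono hle hh
    refine ⟨⟨h, hhb⟩, ⟨h⁻¹ * y.out, mul_mem (inv_mem hhb) y.out.2⟩, ?_, hh.1, hd⟩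
    exact Subtype.ext (mul_inv_cancel_left h
      (y.out : Matrix.SpecialLinearGroup (Fin 2) R)).symm
  obtain ⟨q', hq'⟩ := exists_mul_tildeMat_of_dvd hq
  obtain ⟨h', hh'⟩ := exists_tildeMat_mul_of_mem hh
  obtain ⟨y', p, hp⟩ := exists_cosetRep_mul (α := β) (x.out * h')
  obtain ⟨x', r, hr⟩ := exists_cosetRep_mul (α := α) p
  refine ⟨(y', x'), (r * q')⁻¹, ?_⟩
  have key : cosetRep x * cosetRep y = cosetRep y' * cosetRep x' * mat (r * q') := by
    calc cosetRep x * cosetRep y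
        = mat x.out * (tildeMat α * mat h) * (mat q * tildeMat β) := by
          rw [cosetRep, cosetRep, hy, mat_mul]; simp only [Matrix.mul_assoc]
      _ = mat x.out * mat h' * (tildeMat α * tildeMat β) * mat q' := by
          rw [hh', hq']; simp only [Matrix.mul_assoc]
      _ = mat (x.out * h') * tildeMat β * tildeMat α * mat q' := by
          rw [tildeMat_comm, mat_mul]; simp only [Matrix.mul_assoc]
      _ = cosetRep y' * (mat p * tildeMat α) * mat q' := by
          rw [hp]; simp only [Matrix.mul_assoc]
      _ = cosetRep y' * cosetRep x' * mat (r * q') := by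
          rw [hr, mat_mul]; simp only [Matrix.mul_assoc]
  change cosetRep y' * cosetRep x' = cosetRep x * cosetRep y * _
  rw [key, Matrix.mul_assoc, mat_mul_inv, Matrix.mul_one]

theorem heckeFun_comm_of_not_dvd (hα : Prime α) (hβ : Prime β) (hαβ : ¬ α ∣ β) (hβα : ¬ β ∣ α)
    [Finite (HeckeIndex (Gamma1 𝔟) α)] [Finite (HeckeIndex (Gamma1 𝔟) β)]
    (hα' : IsUnit (Ideal.Quotient.mk 𝔫 α)) (hβ' : IsUnit (Ideal.Quotient.mk 𝔫 β))
    {c : Gamma1 𝔟 → k}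
    (hc : c ∈ groupCohomology.cocycles₁ (coeff (Gamma1 𝔟) (trivialRep 𝔫 k))) :
    heckeFun (trivialRep 𝔫 k) hα' (heckeFun (trivialRep 𝔫 k) hβ' c) =
      heckeFun (trivialRep 𝔫 k) hβ' (heckeFun (trivialRep 𝔫 k) hα' c) := by
  have _ := Fintype.ofFinite (HeckeIndex (Gamma1 𝔟) α)
  have _ := Fintype.ofFinite (HeckeIndex (Gamma1 𝔟) β)
  funext g
  simp only [heckeFun_trivial, finsum_eq_sum_of_fintype]
  rw [← Fintype.sum_prod_type' (f := fun x y => c (transfer (transfer g x) y)),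
    ← Fintype.sum_prod_type' (f := fun x y => c (transfer (transfer g x) y))]
  choose j r hjr using exists_pair_swap (𝔟 := 𝔟) hα hαβ
  have hj : Function.Injective j := by
    intro p p' h
    refine pair_injective hβ hβα p p' (r p * (r p')⁻¹) ?_
    rw [mat_mul, ← Matrix.mul_assoc, ← hjr, h, hjr, Matrix.mul_assoc, mat_mul_inv, Matrix.mul_one]
  have hu : ∀ {α β : R}, IsUnit (Ideal.Quotient.mk 𝔫 α) → IsUnit (Ideal.Quotient.mk 𝔫 β) →
      ∀ p : HeckeIndex (Gamma1 𝔟) α × HeckeIndex (Gamma1 𝔟) β,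
      IsUnit (Ideal.Quotient.mk 𝔫 (cosetRep p.1 * cosetRep p.2).det) := by
    intro α β h h' p
    rw [Matrix.det_mul, det_cosetRep, det_cosetRep, map_mul]
    exact h.mul h'
  refine sum_change_transversal_trivial hc
    (δ₁ := fun p : HeckeIndex (Gamma1 𝔟) β × HeckeIndex (Gamma1 𝔟) α =>
      cosetRep p.1 * cosetRep p.2)
    (δ₂ := fun p : HeckeIndex (Gamma1 𝔟) α × HeckeIndex (Gamma1 𝔟) β =>
      cosetRep p.1 * cosetRep p.2)
    (hu hβ' hα') (hu hα' hβ') (fun p => ?_) (pair_injective hα hαβ)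
    ((Fintype.bijective_iff_injective_and_card j).mpr ⟨hj, ?_⟩) hjr g (pairPerm g) (pairPerm g)
    (pairPerm_spec g) (pairPerm_spec g)
  · rw [Matrix.det_mul, det_cosetRep, det_cosetRep]
    exact mul_ne_zero hα.ne_zero hβ.ne_zero
  · rw [Fintype.card_prod, Fintype.card_prod, mul_comm]

omit [IsDedekindDomain R] in
theorem exists_conj_tildeMat {u : R} (hu : IsUnit u) (g : Gamma1 𝔟) :
    ∃ h : Gamma1 𝔟, mat g * tildeMat u = tildeMat u * mat h :=
  exists_mul_tildeMat_of_dvd hu.dvd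

/-- Conjugation by `ũ` for a unit `u`, which normalises `Γ₁(𝔟)`: `g ↦ ũ⁻¹ g ũ`. -/
def conjUnit {u : R} (hu : IsUnit u) (g : Gamma1 𝔟) : Gamma1 𝔟 := (exists_conj_tildeMat hu g).choose

omit [IsDedekindDomain R] in
theorem conjUnit_spec {u : R} (hu : IsUnit u) (g : Gamma1 𝔟) :
    mat g * tildeMat u = tildeMat u * mat (conjUnit hu g) :=
  (exists_conj_tildeMat hu g).choose_spec

omit [IsDedekindDomain R] in
theorem nat_card_heckeIndex_mul_unit {u : R} (hu : IsUnit u) :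
    Nat.card (HeckeIndex (Gamma1 𝔟) (α * u)) = Nat.card (HeckeIndex (Gamma1 𝔟) α) := by
  have : upperSubgroup (Gamma1 𝔟) (α * u) = upperSubgroup (Gamma1 𝔟) α := by
    ext g
    rw [mem_upperSubgroup_iff, mem_upperSubgroup_iff, hu.mul_right_dvd]
  unfold HeckeIndex
  rw [this]

variable [Finite (HeckeIndex (Gamma1 𝔟) α)]

/-- For a unit `u`, the operator of `αu` is that of `α` after conjugation of the argument by `ũ`:
the cosets are represented by the `γ_x ũ`. -/
theorem heckeFun_mul_unit {u : R} (hu : IsUnit u) (h0 : α ≠ 0)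
    [Finite (HeckeIndex (Gamma1 𝔟) (α * u))]
    (hα : IsUnit (Ideal.Quotient.mk 𝔫 α)) (hαu : IsUnit (Ideal.Quotient.mk 𝔫 (α * u)))
    {c : Gamma1 𝔟 → k}
    (hc : c ∈ groupCohomology.cocycles₁ (coeff (Gamma1 𝔟) (trivialRep 𝔫 k))) :
    heckeFun (trivialRep 𝔫 k) hαu c = heckeFun (trivialRep 𝔫 k) hα (c ∘ conjUnit hu) := by
  have _ := Fintype.ofFinite (HeckeIndex (Gamma1 𝔟) α)
  have _ := Fintype.ofFinite (HeckeIndex (Gamma1 𝔟) (α * u))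
  funext g
  simp only [heckeFun_trivial, finsum_eq_sum_of_fintype, Function.comp_apply]
  have hex : ∀ y : HeckeIndex (Gamma1 𝔟) (α * u), ∃ (x : HeckeIndex (Gamma1 𝔟) α) (k : Gamma1 𝔟),
      cosetRep x * tildeMat u = cosetRep y * mat k := by
    intro y
    obtain ⟨x, k, hk⟩ := exists_cosetRep_mul (α := α) y.out
    refine ⟨x, (conjUnit hu k)⁻¹, ?_⟩
    have hy : cosetRep y = cosetRep x * tildeMat u * mat (conjUnit hu k) := by
      rw [Matrix.mul_assoc, ← conjUnit_spec hu, ← Matrix.mul_assoc, ← hk, Matrix.mul_assoc,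
        tildeMat_mul]
      rfl
    rw [hy, Matrix.mul_assoc, mat_mul_inv, Matrix.mul_one]
  choose j r hjr using hex
  have hj : Function.Injective j := by
    intro y y' h
    refine eq_of_cosetRep_mul_eq (k := r y * (r y')⁻¹) ?_
    rw [mat_mul, ← Matrix.mul_assoc, ← hjr, h, hjr, Matrix.mul_assoc, mat_mul_inv, Matrix.mul_one]
  have hdet : ∀ x : HeckeIndex (Gamma1 𝔟) α, (cosetRep x * tildeMat u).det = α * u := by
    intro x
    rw [Matrix.det_mul, det_cosetRep, det_tildeMat]
  refine (sum_change_transversal_trivial hc (δ₁ := fun y => cosetRep y)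
    (δ₂ := fun x : HeckeIndex (Gamma1 𝔟) α => cosetRep x * tildeMat u)
    (fun y => by rwa [det_cosetRep]) (fun x => by rwa [hdet])
    (fun x => by rw [hdet]; exact mul_ne_zero h0 hu.ne_zero) (fun x x' k h => ?_)
    (hj.bijective_of_nat_card_le (nat_card_heckeIndex_mul_unit hu).ge) hjr g
    (MulAction.toPerm g⁻¹) (fun x => g⁻¹ • x) (transfer_spec g) (fun x => ?_)).symm
  · obtain ⟨k', hk'⟩ := exists_tildeMat_mul_of_mem (𝔟 := 𝔟) (α := u) (g := k) (by
      rw [Ideal.span_singleton_eq_top.mpr hu, Ideal.top_mul]; exact k.2.1)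
    obtain ⟨v, rfl⟩ := hu
    refine eq_of_cosetRep_mul_eq (k := k') ?_
    have h1 : tildeMat (v : R) * tildeMat ((v⁻¹ : Rˣ) : R) = 1 := by
      rw [tildeMat_mul, Units.mul_inv]
      ext i j
      fin_cases i <;> fin_cases j <;> simp [tildeMat]
    rw [Matrix.mul_assoc, hk', ← Matrix.mul_assoc] at h
    simpa only [Matrix.mul_assoc, h1, Matrix.mul_one] using
      congrArg (· * tildeMat ((v⁻¹ : Rˣ) : R)) h
  · rw [← Matrix.mul_assoc, transfer_spec, Matrix.mul_assoc, conjUnit_spec hu, Matrix.mul_assoc]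

/-- The companion of `heckeFun_mul_unit` for the representatives `ũ γ_x`. The two together show that
conjugation by `ũ` commutes with the operator of `α`. -/
theorem heckeFun_mul_unit' {u : R} (hu : IsUnit u) (h0 : α ≠ 0)
    [Finite (HeckeIndex (Gamma1 𝔟) (α * u))]
    (hα : IsUnit (Ideal.Quotient.mk 𝔫 α)) (hαu : IsUnit (Ideal.Quotient.mk 𝔫 (α * u)))
    {c : Gamma1 𝔟 → k}
    (hc : c ∈ groupCohomology.cocycles₁ (coeff (Gamma1 𝔟) (trivialRep 𝔫 k))) :
    heckeFun (trivialRep 𝔫 k) hαu c = heckeFun (trivialRep 𝔫 k) hα c ∘ conjUnit hu := by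
  have _ := Fintype.ofFinite (HeckeIndex (Gamma1 𝔟) α)
  have _ := Fintype.ofFinite (HeckeIndex (Gamma1 𝔟) (α * u))
  funext g
  simp only [heckeFun_trivial, finsum_eq_sum_of_fintype, Function.comp_apply]
  have hex : ∀ y : HeckeIndex (Gamma1 𝔟) (α * u), ∃ (x : HeckeIndex (Gamma1 𝔟) α) (k : Gamma1 𝔟),
      tildeMat u * cosetRep x = cosetRep y * mat k := by
    intro y
    obtain ⟨x, k, hk⟩ := exists_cosetRep_mul (α := α) (conjUnit hu y.out)
    refine ⟨x, k⁻¹, ?_⟩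
    have hy : cosetRep y = tildeMat u * cosetRep x * mat k := by
      rw [Matrix.mul_assoc, ← hk, ← Matrix.mul_assoc, ← conjUnit_spec hu, Matrix.mul_assoc,
        tildeMat_comm, tildeMat_mul]
      rfl
    rw [hy, Matrix.mul_assoc, mat_mul_inv, Matrix.mul_one]
  choose j r hjr using hex
  have hj : Function.Injective j := by
    intro y y' h
    refine eq_of_cosetRep_mul_eq (k := r y * (r y')⁻¹) ?_
    rw [mat_mul, ← Matrix.mul_assoc, ← hjr, h, hjr, Matrix.mul_assoc, mat_mul_inv, Matrix.mul_one]
  have hdet : ∀ x : HeckeIndex (Gamma1 𝔟) α, (tildeMat u * cosetRep x).det = α * u := by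
    intro x
    rw [Matrix.det_mul, det_cosetRep, det_tildeMat, mul_comm]
  refine (sum_change_transversal_trivial hc (δ₁ := fun y => cosetRep y)
    (δ₂ := fun x : HeckeIndex (Gamma1 𝔟) α => tildeMat u * cosetRep x)
    (fun y => by rwa [det_cosetRep]) (fun x => by rwa [hdet])
    (fun x => by rw [hdet]; exact mul_ne_zero h0 hu.ne_zero) (fun x x' k h => ?_)
    (hj.bijective_of_nat_card_le (nat_card_heckeIndex_mul_unit hu).ge) hjr g
    (MulAction.toPerm g⁻¹) (fun x => (conjUnit hu g)⁻¹ • x) (transfer_spec g) (fun x => ?_)).symm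
  · rw [Matrix.mul_assoc] at h
    exact eq_of_cosetRep_mul_eq
      (mul_left_cancel_of_det_ne_zero (by rw [det_tildeMat]; exact hu.ne_zero) h)
  · rw [← Matrix.mul_assoc, conjUnit_spec hu, Matrix.mul_assoc, transfer_spec, Matrix.mul_assoc]

/-- The Hecke operators on the cohomology with trivial coefficients commute, already on cocycles.
Operators of non-associate primes commute by an exchange of the two transversals; those of associate
primes differ by conjugation with `ũ` for a unit `u`. -/
theorem heckeFun_comm [Finite (HeckeIndex (Gamma1 𝔟) β)] (hα : Prime α) (hβ : Prime β)
    (hα' : IsUnit (Ideal.Quotient.mk 𝔫 α)) (hβ' : IsUnit (Ideal.Quotient.mk 𝔫 β))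
    {c : Gamma1 𝔟 → k}
    (hc : c ∈ groupCohomology.cocycles₁ (coeff (Gamma1 𝔟) (trivialRep 𝔫 k))) :
    heckeFun (trivialRep 𝔫 k) hα' (heckeFun (trivialRep 𝔫 k) hβ' c) =
      heckeFun (trivialRep 𝔫 k) hβ' (heckeFun (trivialRep 𝔫 k) hα' c) := by
  by_cases h : Associated α β
  · obtain ⟨u, rfl⟩ := h
    rw [heckeFun_mul_unit' u.isUnit hα.ne_zero hα' hβ' hc,
      heckeFun_mul_unit u.isUnit hα.ne_zero hα' hβ'
        (heckeFun_mem_cocycles _ hα.ne_zero hα' hc)]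
  · exact heckeFun_comm_of_not_dvd hα hβ
      (fun h' => h (hα.associated_of_dvd hβ h'))
      (fun h' => h (hβ.associated_of_dvd hα h').symm) hα' hβ' hc

end Commute

/-! ### Characters of `𝔽_ℓˣ × 𝔽_ℓˣ` and generators of `SL₂(𝔽_ℓ × 𝔽_ℓ)` -/

section Characters

variable {ℓ : ℕ} [Fact ℓ.Prime]

/-- A commutative group of exponent dividing `ℓ - 1` that acts on a finite-dimensional
`𝔽_ℓ`-vector space acts through a character on some line in any non-zero stable subspace. -/
theorem exists_character_eigenvector {V M : Type*} [AddCommGroup V] [Module (ZMod ℓ) V]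
    [FiniteDimensional (ZMod ℓ) V] [CommGroup M] (hM : ∀ m : M, m ^ (ℓ - 1) = 1)
    (D : M →* Module.End (ZMod ℓ) V) {S : Submodule (ZMod ℓ) V} (hS : ∀ m, ∀ v ∈ S, D m v ∈ S)
    (hS0 : S ≠ ⊥) :
    ∃ v ∈ S, v ≠ 0 ∧ ∃ χ : M →* (ZMod ℓ)ˣ, ∀ m, D m v = (χ m : ZMod ℓ) • v := by
  obtain ⟨v, hv, hv0, h⟩ := exists_common_eigenvector (D := D)
    (fun i j => by rw [commute_iff_eq, ← map_mul, ← map_mul, mul_comm])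
    (fun m => by rw [← map_pow, hM, map_one]) hS hS0
  choose a ha using h
  let χ : M →* ZMod ℓ :=
    { toFun := a
      map_one' := smul_left_injective _ hv0 (by
        change a 1 • v = (1 : ZMod ℓ) • v
        rw [← ha, map_one, one_smul]; rfl)
      map_mul' := fun m n => smul_left_injective _ hv0 (by
        change a (m * n) • v = (a m * a n) • v
        rw [← ha, map_mul, Module.End.mul_apply, ha n, map_smul, ha m, smul_smul, mul_comm]) }
  exact ⟨v, hv, hv0, χ.toHomUnits, ha⟩

variable {A : Type} [CommRing A] (e : A ≃+* ZMod ℓ × ZMod ℓ)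

include e in
theorem units_pow_eq_one (t : Aˣ) : t ^ (ℓ - 1) = 1 := by
  apply Units.ext
  apply e.injective
  have h : ∀ x : (ZMod ℓ × ZMod ℓ)ˣ, (x : ZMod ℓ × ZMod ℓ) ^ (ℓ - 1) = 1 := by
    intro x
    have h1 := ZMod.pow_card_sub_one_eq_one (p := ℓ) (a := (x : ZMod ℓ × ZMod ℓ).1)
      (x.isUnit.map (RingHom.fst _ _)).ne_zero
    have h2 := ZMod.pow_card_sub_one_eq_one (p := ℓ) (a := (x : ZMod ℓ × ZMod ℓ).2)
      (x.isUnit.map (RingHom.snd _ _)).ne_zero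
    exact Prod.ext h1 h2
  simpa using h (Units.map (e : A →* ZMod ℓ × ZMod ℓ) t)

/-- The endomorphisms of the cyclic group `𝔽_ℓˣ` are powers. For `ℓ = 2` the truncated `ℓ - 2` is
the correct bound `0`. -/
theorem exists_pow_of_hom (σ : (ZMod ℓ)ˣ →* (ZMod ℓ)ˣ) :
    ∃ a ≤ ℓ - 2, ∀ x, σ x = x ^ a := by
  have hℓ := (Fact.out : ℓ.Prime).two_le
  obtain ⟨m, hm⟩ := MonoidHom.map_cyclic σ
  have hpos : (0 : ℤ) < (ℓ - 1 : ℕ) := by omega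
  refine ⟨(m % (ℓ - 1 : ℕ)).toNat, ?_, fun x => ?_⟩
  · have := Int.emod_lt_of_pos m hpos
    omega
  · have h1 : x ^ (ℓ - 1) = 1 := by
      have := ZMod.pow_card_sub_one_eq_one (p := ℓ) (a := (x : ZMod ℓ)) x.ne_zero
      exact Units.ext (by simpa using this)
    rw [hm, ← zpow_natCast x (m % (ℓ - 1 : ℕ)).toNat,
      Int.toNat_of_nonneg (Int.emod_nonneg _ hpos.ne')]
    conv_lhs => rw [← Int.emod_add_mul_ediv m (ℓ - 1 : ℕ)]
    rw [zpow_add, zpow_mul, zpow_natCast x (ℓ - 1), h1, one_zpow, mul_one]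

/-- The characters of `𝔽_ℓˣ × 𝔽_ℓˣ` with values in `𝔽_ℓˣ` are products of powers of the two
projections. -/
theorem exists_pow_mul_pow_of_hom (χ : Aˣ →* (ZMod ℓ)ˣ) :
    ∃ a ≤ ℓ - 2, ∃ b ≤ ℓ - 2, ∀ x : Aˣ, (χ x : ZMod ℓ) = (e x).1 ^ a * (e x).2 ^ b := by
  let E : Aˣ ≃* (ZMod ℓ)ˣ × (ZMod ℓ)ˣ := (Units.mapEquiv e.toMulEquiv).trans MulEquiv.prodUnits
  obtain ⟨a, ha, hσ⟩ := exists_pow_of_hom ((χ.comp E.symm.toMonoidHom).comp (MonoidHom.inl _ _))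
  obtain ⟨b, hb, hσ'⟩ := exists_pow_of_hom ((χ.comp E.symm.toMonoidHom).comp (MonoidHom.inr _ _))
  refine ⟨a, ha, b, hb, fun x => ?_⟩
  have h1 : χ x = (E x).1 ^ a * (E x).2 ^ b := by
    rw [← hσ, ← hσ']
    simp only [MonoidHom.comp_apply, ← map_mul]
    congr 1
    apply E.injective
    ext <;> simp
  rw [h1]
  rfl

include e in
/-- The ring `𝔽_ℓ × 𝔽_ℓ` has stable rank one. -/
theorem exists_isUnit_add_mul {c d x y : A} (h : x * c + y * d = 1) : ∃ t, IsUnit (d + c * t) := by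
  have key : ∀ c d x y : ZMod ℓ, x * c + y * d = 1 → ∃ t, d + c * t ≠ 0 := by
    intro c d x y h
    by_cases hd : d = 0
    · refine ⟨1, fun h0 => ?_⟩
      have hc : c = 0 := by simpa [hd] using h0
      simp [hc, hd] at h
    · exact ⟨0, by simpa using hd⟩
  have h' := congrArg e h
  simp only [map_add, map_mul, map_one] at h'
  obtain ⟨t₁, h₁⟩ := key _ _ _ _ (congrArg Prod.fst h')
  obtain ⟨t₂, h₂⟩ := key _ _ _ _ (congrArg Prod.snd h')
  refine ⟨e.symm (t₁, t₂), ?_⟩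
  rw [← MulEquiv.isUnit_map e, map_add, map_mul, e.apply_symm_apply, Prod.isUnit_iff]
  exact ⟨h₁.isUnit, h₂.isUnit⟩

/-- A matrix of determinant one whose lower right entry is a unit `u` is `(1 r; 0 1)` times
`diag(u⁻¹, u)` times `(1 0; s 1)`; the diagonal factor is written in elementary matrices. -/
theorem upper_mul_diag_mul_lower (u v r s : A) (huv : u * v = 1) :
    upper r * (upper v * lower (-u) * upper v * (upper (-1) * lower 1 * upper (-1))) * lower s =
      ⟨!![v + r * u * s, r * u; u * s, u], by
        rw [Matrix.det_fin_two_of]; linear_combination huv⟩ := by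
  apply Subtype.ext
  change !![1, r; 0, 1] * (!![1, v; 0, 1] * !![1, 0; -u, 1] * !![1, v; 0, 1] *
    (!![1, -1; 0, 1] * !![1, 0; 1, 1] * !![1, -1; 0, 1])) * !![1, 0; s, 1] =
    !![v + r * u * s, r * u; u * s, u]
  simp only [Matrix.mul_fin_two]
  congr! 4 <;> grind

include e in
/-- `SL₂(𝔽_ℓ × 𝔽_ℓ)` is generated by elementary matrices. -/
theorem eq_top_of_elementary_mem {S : Subgroup (Matrix.SpecialLinearGroup (Fin 2) A)}
    (hu : ∀ t, upper t ∈ S) (hl : ∀ t, lower t ∈ S) : S = ⊤ := by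
  -- A column operation makes the lower right entry a unit, which reduces to the case of a product
  -- of elementary matrices.
  have hunit : ∀ g : Matrix.SpecialLinearGroup (Fin 2) A, IsUnit (g 1 1) → g ∈ S := by
    rintro g ⟨u, hu'⟩
    have hd : g 0 0 * g 1 1 - g 0 1 * g 1 0 = 1 := by
      rw [← Matrix.det_fin_two, g.det_coe]
    have huv : (u : A) * (u⁻¹ : Aˣ) = 1 := Units.mul_inv u
    have hg : g = upper (g 0 1 * (u⁻¹ : Aˣ)) * (upper ((u⁻¹ : Aˣ) : A) * lower (-(u : A)) *
        upper ((u⁻¹ : Aˣ) : A) * (upper (-1) * lower 1 * upper (-1))) *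
        lower ((u⁻¹ : Aˣ) * g 1 0) := by
      rw [upper_mul_diag_mul_lower _ _ _ _ huv]
      apply Subtype.ext
      ext i j
      rw [← hu'] at hd
      fin_cases i <;> fin_cases j
      · change g 0 0 = ((u⁻¹ : Aˣ) : A) + g 0 1 * (u⁻¹ : Aˣ) * u * ((u⁻¹ : Aˣ) * g 1 0)
        linear_combination ((u⁻¹ : Aˣ) : A) * hd - (g 0 0 + g 0 1 * g 1 0 * (u⁻¹ : Aˣ)) * huv
      · change g 0 1 = g 0 1 * (u⁻¹ : Aˣ) * u
        linear_combination -g 0 1 * huv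
      · change g 1 0 = u * ((u⁻¹ : Aˣ) * g 1 0)
        linear_combination -g 1 0 * huv
      · exact hu'.symm
    rw [hg]
    exact mul_mem (mul_mem (hu _) (mul_mem (mul_mem (mul_mem (hu _) (hl _)) (hu _))
      (mul_mem (mul_mem (hu _) (hl _)) (hu _)))) (hl _)
  rw [eq_top_iff]
  intro g _
  have hd : g 0 0 * g 1 1 - g 0 1 * g 1 0 = 1 := by
    rw [← Matrix.det_fin_two, g.det_coe]
  obtain ⟨t, ht⟩ := exists_isUnit_add_mul e (c := g 1 0) (d := g 1 1) (x := -g 0 1) (y := g 0 0)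
    (by linear_combination hd)
  have h1 : g * upper t ∈ S := by
    refine hunit _ ?_
    have : (g * upper t) 1 1 = g 1 1 + g 1 0 * t := by
      rw [Matrix.SpecialLinearGroup.coe_mul, Matrix.mul_apply, Fin.sum_univ_two]
      simp [upper, add_comm]
    rwa [this]
  simpa using mul_mem h1 (inv_mem (hu t))

end Characters

/-! ### A semi-invariant functional -/

section SemiInvariant

variable {ℓ : ℕ} [Fact ℓ.Prime] {A : Type} [CommRing A] (e : A ≃+* ZMod ℓ × ZMod ℓ)

/-- The homomorphism `y ↦ (1 y; 0 1)`. -/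
def unipotent : Multiplicative A →* GL (Fin 2) A where
  toFun y := Matrix.GeneralLinearGroup.mk'' !![1, y.toAdd; 0, 1] (by simp)
  map_one' := by
    ext i j
    fin_cases i <;> fin_cases j <;> simp
  map_mul' x y := by
    ext i j
    fin_cases i <;> fin_cases j <;> simp [Matrix.mul_apply, Fin.sum_univ_two, add_comm]

/-- The homomorphism `x ↦ (1 0; 0 x)`. -/
def diagOne : Aˣ →* GL (Fin 2) A where
  toFun x := Matrix.GeneralLinearGroup.mk'' !![1, 0; 0, (x : A)] (by simp)
  map_one' := by
    ext i j
    fin_cases i <;> fin_cases j <;> simp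
  map_mul' x y := by
    ext i j
    fin_cases i <;> fin_cases j <;> simp [Matrix.mul_apply, Fin.sum_univ_two]

theorem diagOne_mul_unipotent_comm (x : Aˣ) (y : A) :
    unipotent (Multiplicative.ofAdd y) * diagOne x =
      diagOne x * unipotent (Multiplicative.ofAdd (y * x)) := by
  ext i j
  fin_cases i <;> fin_cases j <;>
    simp [unipotent, diagOne, Matrix.mul_apply, Fin.sum_univ_two, mul_comm]

include e in
/-- Every non-zero right `GL₂(𝔽_ℓ × 𝔽_ℓ)`-module in characteristic `ℓ` has a linear functional
on which the matrices `(1 y; 0 x)` act through a character of `x`: the `ℓ`-group of the matrices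
`(1 y; 0 1)` has a non-zero fixed vector in the dual space, and the matrices `(1 0; 0 x)` act
diagonalisably on the space of these. -/
theorem exists_semiinvariant {X : Type} [AddCommGroup X] [Module (ZMod ℓ) X]
    [FiniteDimensional (ZMod ℓ) X] [Nontrivial X]
    (ρ : Representation (ZMod ℓ) (GL (Fin 2) A)ᵐᵒᵖ X) :
    ∃ f : Module.Dual (ZMod ℓ) X, f ≠ 0 ∧ ∃ χ : Aˣ →* (ZMod ℓ)ˣ, ∀ (x : Aˣ) (y : A) (v : X),
      f (ρ (op (diagOne x * unipotent (Multiplicative.ofAdd y))) v) = (χ x : ZMod ℓ) * f v := by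
  let act : GL (Fin 2) A →* Module.End (ZMod ℓ) (Module.Dual (ZMod ℓ) X) :=
    { toFun := fun g => Module.Dual.transpose (ρ (op g))
      map_one' := by ext f v; simp [Module.Dual.transpose]
      map_mul' := fun g h => by ext f v; simp [Module.Dual.transpose] }
  have hact : ∀ g f v, act g f v = f (ρ (op g) v) := fun g f v => rfl
  let S : Submodule (ZMod ℓ) (Module.Dual (ZMod ℓ) X) :=
    { carrier := {f | ∀ y, act (unipotent y) f = f}
      add_mem' := fun hf hg y => by rw [map_add, hf, hg]
      zero_mem' := fun y => map_zero _
      smul_mem' := fun a f hf y => by rw [map_smul, hf] }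
  have hS : ∀ m : Aˣ, ∀ f ∈ S, (act.comp diagOne) m f ∈ S := by
    intro m f hf y
    change act (unipotent y) (act (diagOne m) f) = act (diagOne m) f
    obtain ⟨y, rfl⟩ := Multiplicative.ofAdd.surjective y
    rw [← Module.End.mul_apply, ← map_mul, diagOne_mul_unipotent_comm, map_mul,
      Module.End.mul_apply, hf]
  have hS0 : S ≠ ⊥ := by
    have hp : IsPGroup ℓ (Multiplicative A) := by
      intro y
      refine ⟨1, ?_⟩
      obtain ⟨y, rfl⟩ := Multiplicative.ofAdd.surjective y
      rw [pow_one, ← ofAdd_nsmul, nsmul_eq_mul]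
      have : (ℓ : A) = 0 := e.injective (by
        rw [map_natCast, map_zero]; ext <;> simp)
      rw [this, zero_mul]; rfl
    let _ : MulAction (Multiplicative A) (Module.Dual (ZMod ℓ) X) :=
      { smul := fun y f => act (unipotent y) f
        one_smul := fun f => by
          change act (unipotent 1) f = f
          rw [map_one, map_one]; rfl
        mul_smul := fun y z f => by
          change act (unipotent (y * z)) f = act (unipotent y) (act (unipotent z) f)
          rw [map_mul, map_mul]; rfl }
    have : Finite (Module.Dual (ZMod ℓ) X) := Module.finite_of_finite (ZMod ℓ)
    have hdvd : ℓ ∣ Nat.card (Module.Dual (ZMod ℓ) X) := by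
      rw [Module.natCard_eq_pow_finrank (K := ZMod ℓ), Nat.card_zmod]
      exact dvd_pow_self _ Module.finrank_pos.ne'
    obtain ⟨f, hf, hf0⟩ := hp.exists_fixed_point_of_prime_dvd_card_of_fixed_point
      (Module.Dual (ZMod ℓ) X) hdvd (a := 0) (fun y => map_zero (act (unipotent y)))
    exact fun h => hf0 ((Submodule.mem_bot (ZMod ℓ)).mp (h ▸ (hf : f ∈ S))).symm
  obtain ⟨f, hf, hf0, χ, hχ⟩ := exists_character_eigenvector (units_pow_eq_one e)
    (act.comp diagOne) hS hS0
  refine ⟨f, hf0, χ, fun x y v => ?_⟩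
  rw [← hact, map_mul, Module.End.mul_apply, hf]
  change act.comp diagOne x f v = _
  rw [hχ]
  rfl

end SemiInvariant

/-! ### Reduction modulo `ℓ` -/

section Reduction

variable {R : Type} [CommRing R] [IsDomain R] {ℓ : ℕ} [Fact ℓ.Prime] {lam lam' : R}
  {τ₁ τ₂ : R →+* ZMod ℓ}

/-- The isomorphism `R/(ℓ) ≃ 𝔽_ℓ × 𝔽_ℓ` that is given by the two reduction maps. -/
theorem exists_equiv_prod (hlam : Prime lam) (hlam' : Prime lam') (hne : ¬ Associated lam lam')
    (hsplit : (ℓ : R) = lam * lam') (hτ₁ : RingHom.ker τ₁ = Ideal.span {lam})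
    (hτ₂ : RingHom.ker τ₂ = Ideal.span {lam'}) :
    ∃ e : (R ⧸ Ideal.span {(ℓ : R)}) ≃+* ZMod ℓ × ZMod ℓ,
      ∀ r : R, e (Ideal.Quotient.mk _ r) = (τ₁ r, τ₂ r) := by
  have h1 : ∀ r, τ₁ r = 0 ↔ lam ∣ r := fun r => by
    rw [← RingHom.mem_ker, hτ₁, Ideal.mem_span_singleton]
  have h2 : ∀ r, τ₂ r = 0 ↔ lam' ∣ r := fun r => by
    rw [← RingHom.mem_ker, hτ₂, Ideal.mem_span_singleton]
  have hlam2 : τ₂ lam ≠ 0 := fun h =>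
    hne ((hlam'.associated_of_dvd hlam ((h2 _).mp h)).symm)
  have hker : RingHom.ker (τ₁.prod τ₂) = Ideal.span {(ℓ : R)} := by
    ext r
    rw [RingHom.mem_ker, Ideal.mem_span_singleton, RingHom.prod_apply, Prod.mk_eq_zero, h1, h2,
      hsplit]
    refine ⟨?_, fun h => ⟨dvd_of_mul_right_dvd h, dvd_of_mul_left_dvd h⟩⟩
    rintro ⟨⟨s, rfl⟩, h⟩
    refine mul_dvd_mul_left _ ((h2 _).mp ?_)
    simpa [hlam2] using (h2 _).mpr h
  have hsurj : Function.Surjective (τ₁.prod τ₂) := by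
    rintro ⟨x, y⟩
    -- The Chinese remainder theorem with explicit lifts from `𝔽_ℓ`.
    refine ⟨(x.val : R) + lam * (((y - x) / τ₂ lam).val : R), ?_⟩
    have : τ₁ lam = 0 := (h1 _).mpr dvd_rfl
    refine Prod.ext ?_ ?_
    · simp [this]
    · change τ₂ _ = y
      rw [map_add, map_mul, map_natCast, map_natCast, ZMod.natCast_zmod_val,
        ZMod.natCast_zmod_val, mul_div_cancel₀ _ hlam2, add_sub_cancel]
  refine ⟨(Ideal.quotEquivOfEq hker.symm).trans
    (RingHom.quotientKerEquivOfSurjective hsurj), fun r => rfl⟩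

/-- The reduction modulo `𝔫` on a congruence subgroup. -/
def redHom (𝔟 𝔫 : Ideal R) : Gamma1 𝔟 →* Matrix.SpecialLinearGroup (Fin 2) (R ⧸ 𝔫) :=
  (Matrix.SpecialLinearGroup.map (Ideal.Quotient.mk 𝔫)).comp (Gamma1 𝔟).subtype

omit [IsDomain R] in
/-- Strong approximation: `Γ₁(𝔞)` surjects onto `SL₂(R/(ℓ))` if `𝔞` is prime to `ℓ`. Here
`𝔫` stands for `(ℓ)`; elementary matrices over `R/𝔫` lift to elementary matrices in `Γ₁(𝔞)`. -/
theorem redHom_surjective {𝔞 𝔫 : Ideal R} (e : (R ⧸ 𝔫) ≃+* ZMod ℓ × ZMod ℓ)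
    (h𝔞 : IsCoprime 𝔞 𝔫) : Function.Surjective (redHom 𝔞 𝔫) := by
  rw [← MonoidHom.range_eq_top]
  obtain ⟨x, hx, y, hy, hxy⟩ := Submodule.mem_sup.mp
    ((Ideal.isCoprime_iff_sup_eq.mp h𝔞).symm ▸ Submodule.mem_top : (1 : R) ∈ 𝔞 ⊔ 𝔫)
  have hx1 : Ideal.Quotient.mk 𝔫 x = 1 := by
    rw [← map_one (Ideal.Quotient.mk 𝔫), ← hxy, map_add, Ideal.Quotient.eq_zero_iff_mem.mpr hy,
      add_zero]
  refine eq_top_of_elementary_mem e (fun t => ?_) (fun t => ?_)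
  · obtain ⟨r, rfl⟩ := Ideal.Quotient.mk_surjective t
    refine ⟨⟨upper r, upper_mem_Gamma1 _ _⟩, ?_⟩
    apply Subtype.ext
    ext i j
    fin_cases i <;> fin_cases j
    exacts [map_one (Ideal.Quotient.mk 𝔫), rfl, map_zero (Ideal.Quotient.mk 𝔫),
      map_one (Ideal.Quotient.mk 𝔫)]
  · obtain ⟨r, rfl⟩ := Ideal.Quotient.mk_surjective t
    refine ⟨⟨lower (r * x), lower_mem_Gamma1 (𝔞.mul_mem_left _ hx)⟩, ?_⟩
    apply Subtype.ext
    ext i j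
    fin_cases i <;> fin_cases j
    · exact map_one (Ideal.Quotient.mk 𝔫)
    · exact map_zero (Ideal.Quotient.mk 𝔫)
    · change Ideal.Quotient.mk 𝔫 (r * x) = Ideal.Quotient.mk 𝔫 r
      rw [map_mul, hx1, mul_one]
    · exact map_one (Ideal.Quotient.mk 𝔫)

end Reduction

/-! ### Hecke operators on cochains and coboundaries -/

section Coboundary

variable {R : Type} [CommRing R] {Γ : Subgroup (Matrix.SpecialLinearGroup (Fin 2) R)} {α : R}
  {k E : Type} [CommRing k] [AddCommGroup E] [Module k E] {𝔫 : Ideal R}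
  (ρ : Representation k (GL (Fin 2) (R ⧸ 𝔫))ᵐᵒᵖ E)

variable (Γ) in
/-- The coboundary `g ↦ g • v - v` of a vector `v`. -/
def bd : E →ₗ[k] (Γ → E) where
  toFun v g := leftAction ρ g v - v
  map_add' v w := by funext g; simp only [map_add, Pi.add_apply]; abel
  map_smul' a v := by funext g; simp [smul_sub]

theorem mem_coboundaries₁_iff {c : Γ → E} :
    c ∈ groupCohomology.coboundaries₁ (coeff Γ ρ) ↔ ∃ v, bd Γ ρ v = c := Iff.rfl

theorem bd_mem_cocycles₁ (v : E) : bd Γ ρ v ∈ groupCohomology.cocycles₁ (coeff Γ ρ) :=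
  groupCohomology.coboundaries₁_le_cocycles₁ _ ⟨v, rfl⟩

/-- The operator `v ↦ ∑ₓ v · γ_x^ι` on vectors that induces the Hecke operator on coboundaries. -/
def heckeVec (hα : IsUnit (Ideal.Quotient.mk 𝔫 α)) (v : E) : E :=
  ∑ᶠ x : HeckeIndex Γ α, iotaMul ρ hα x v

theorem heckeFun_bd [Finite (HeckeIndex Γ α)] (hα : IsUnit (Ideal.Quotient.mk 𝔫 α)) (v : E) :
    heckeFun ρ hα (bd Γ ρ v) = bd Γ ρ (heckeVec (Γ := Γ) ρ hα v) := by
  have _ := Fintype.ofFinite (HeckeIndex Γ α)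
  funext g
  change ∑ᶠ x : HeckeIndex Γ α, iotaMul ρ hα x (leftAction ρ (transfer g x) v - v) =
    leftAction ρ g (∑ᶠ x : HeckeIndex Γ α, iotaMul ρ hα x v) -
      ∑ᶠ x : HeckeIndex Γ α, iotaMul ρ hα x v
  simp only [finsum_eq_sum_of_fintype, map_sub, iotaMul_transfer, Finset.sum_sub_distrib, map_sum]
  congr 1
  exact Fintype.sum_equiv (MulAction.toPerm g⁻¹) _ _ (fun x => rfl)

theorem heckeFun_add [Finite (HeckeIndex Γ α)] (hα : IsUnit (Ideal.Quotient.mk 𝔫 α))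
    (c d : Γ → E) : heckeFun ρ hα (c + d) = heckeFun ρ hα c + heckeFun ρ hα d := by
  have _ := Fintype.ofFinite (HeckeIndex Γ α)
  funext g
  simp [heckeFun, finsum_eq_sum_of_fintype, Finset.sum_add_distrib]

theorem heckeFun_smul [Finite (HeckeIndex Γ α)] (hα : IsUnit (Ideal.Quotient.mk 𝔫 α))
    (a : k) (c : Γ → E) : heckeFun ρ hα (a • c) = a • heckeFun ρ hα c := by
  have _ := Fintype.ofFinite (HeckeIndex Γ α)
  funext g
  simp [heckeFun, finsum_eq_sum_of_fintype, Finset.smul_sum]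

theorem heckeFun_sub [Finite (HeckeIndex Γ α)] (hα : IsUnit (Ideal.Quotient.mk 𝔫 α))
    (c d : Γ → E) : heckeFun ρ hα (c - d) = heckeFun ρ hα c - heckeFun ρ hα d := by
  rw [sub_eq_add_neg, ← neg_one_smul k d, heckeFun_add, heckeFun_smul, neg_one_smul,
    ← sub_eq_add_neg]

theorem heckeFun_mem [Finite (HeckeIndex Γ α)] {K : Submodule k E} (hK : ∀ g, ∀ v ∈ K, ρ g v ∈ K)
    (hα : IsUnit (Ideal.Quotient.mk 𝔫 α)) {c : Γ → E} (hc : ∀ g, c g ∈ K) (g : Γ) :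
    heckeFun ρ hα c g ∈ K := by
  have _ := Fintype.ofFinite (HeckeIndex Γ α)
  simp only [heckeFun, finsum_eq_sum_of_fintype]
  exact K.sum_mem fun x _ => hK _ _ (hc _)

theorem leftAction_mem {K : Submodule k E} (hK : ∀ g, ∀ v ∈ K, ρ g v ∈ K)
    (g : Matrix.SpecialLinearGroup (Fin 2) R) {v : E} (hv : v ∈ K) : leftAction ρ g v ∈ K :=
  hK _ _ hv

end Coboundary

/-! ### Passage to trivial coefficients at a deeper level -/

section Restriction

variable {R : Type} [CommRing R] [IsDedekindDomain R] {𝔞 𝔠 𝔫 : Ideal R} {π : R}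
  {k E : Type} [Field k] [AddCommGroup E] [Module k E]
  (ρ : Representation k (GL (Fin 2) (R ⧸ 𝔫))ᵐᵒᵖ E)

omit [IsDedekindDomain R] in
theorem rightMul_eq {m : Matrix (Fin 2) (Fin 2) R} (hm : IsUnit (Ideal.Quotient.mk 𝔫 m.det))
    (h0 : Ideal.Quotient.mk 𝔫 (m 0 0) = 1) (h1 : Ideal.Quotient.mk 𝔫 (m 1 0) = 0)
    {x : (R ⧸ 𝔫)ˣ} (hx : Ideal.Quotient.mk 𝔫 (m 1 1) = x) (v : E) :
    rightMul ρ m hm v = ρ (op (diagOne x *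
      unipotent (Multiplicative.ofAdd (Ideal.Quotient.mk 𝔫 (m 0 1))))) v := by
  unfold rightMul
  congr 3
  ext i j
  fin_cases i <;> fin_cases j <;>
    simp [unipotent, diagOne, Matrix.mul_apply, Fin.sum_univ_two, h0, h1, hx]

omit [IsDedekindDomain R] in
theorem mk_apply_of_mem_Gamma1 {g : Matrix.SpecialLinearGroup (Fin 2) R} (hg : g ∈ Gamma1 𝔫) :
    Ideal.Quotient.mk 𝔫 (g 0 0) = 1 ∧ Ideal.Quotient.mk 𝔫 (g 1 0) = 0 ∧
      Ideal.Quotient.mk 𝔫 (g 1 1) = 1 := by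
  have h10 : Ideal.Quotient.mk 𝔫 (g 1 0) = 0 := Ideal.Quotient.eq_zero_iff_mem.mpr hg.1
  have h11 : Ideal.Quotient.mk 𝔫 (g 1 1) = 1 := by
    rw [← map_one (Ideal.Quotient.mk 𝔫)]
    exact Ideal.Quotient.eq.mpr hg.2
  refine ⟨?_, h10, h11⟩
  have hd : g 0 0 * g 1 1 - g 0 1 * g 1 0 = 1 := by
    rw [← Matrix.det_fin_two, g.det_coe]
  simpa [h10, h11] using congrArg (Ideal.Quotient.mk 𝔫) hd

omit [IsDedekindDomain R] in
theorem apply_leftAction_of_mem_Gamma1 {K : Submodule k E} {f : E →ₗ[k] k}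
    {χ : (R ⧸ 𝔫)ˣ →* kˣ}
    (hf : ∀ (x : (R ⧸ 𝔫)ˣ) (y : R ⧸ 𝔫), ∀ v ∈ K,
      f (ρ (op (diagOne x * unipotent (Multiplicative.ofAdd y))) v) = (χ x : k) * f v)
    {g : Matrix.SpecialLinearGroup (Fin 2) R} (hg : g ∈ Gamma1 𝔫) (v : E) (hv : v ∈ K) :
    f (leftAction ρ g v) = f v := by
  obtain ⟨h00, h10, h11⟩ := mk_apply_of_mem_Gamma1 hg
  have hu : IsUnit (Ideal.Quotient.mk 𝔫 (Matrix.adjugate (g : Matrix (Fin 2) (Fin 2) R)).det) := by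
    simp [Matrix.det_adjugate]
  rw [leftAction_apply ρ _ hu, rightMul_eq ρ _ (x := 1), hf _ _ v hv, map_one, Units.val_one,
    one_mul]
  · rw [Matrix.adjugate_fin_two]
    exact h11
  · rw [Matrix.adjugate_fin_two]
    change Ideal.Quotient.mk 𝔫 (-g 1 0) = 0
    rw [map_neg, h10, neg_zero]
  · rw [Matrix.adjugate_fin_two]
    exact h00

/-- A functional on which the matrices `(1 y; 0 x)` act through the character `χ` of `x` turns the
Hecke operator `T_π` on `H¹(Γ₁(𝔞), E)` into the multiple `χ(π) T_π` of the Hecke operator at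
the deeper level `𝔠` with trivial coefficients. -/
theorem apply_heckeFun {K : Submodule k E} (hK : ∀ g, ∀ v ∈ K, ρ g v ∈ K) {f : E →ₗ[k] k}
    {χ : (R ⧸ 𝔫)ˣ →* kˣ}
    (hf : ∀ (x : (R ⧸ 𝔫)ˣ) (y : R ⧸ 𝔫), ∀ v ∈ K,
      f (ρ (op (diagOne x * unipotent (Multiplicative.ofAdd y))) v) = (χ x : k) * f v)
    {c : Gamma1 𝔞 → E} (hc : c ∈ groupCohomology.cocycles₁ (coeff (Gamma1 𝔞) ρ))
    (hcK : ∀ g, c g ∈ K) (hπ : Prime π) (hπ' : IsUnit (Ideal.Quotient.mk 𝔫 π))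
    (hle : 𝔠 ≤ 𝔞) (hle' : 𝔠 ≤ 𝔫) (h𝔠 : 𝔠 ≤ Ideal.span {π} → 𝔞 ≤ Ideal.span {π})
    [Finite (HeckeIndex (Gamma1 𝔞) π)] [Finite (HeckeIndex (Gamma1 𝔠) π)] (g : Gamma1 𝔠) :
    f (heckeFun ρ hπ' c (Subgroup.inclusion (Gamma1_mono hle) g)) =
      (χ hπ'.unit : k) * heckeFun (trivialRep 𝔫 k) hπ'
        (fun h => f (c (Subgroup.inclusion (Gamma1_mono hle) h))) g := by
  set i := Subgroup.inclusion (Gamma1_mono hle)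
  have _ := Fintype.ofFinite (HeckeIndex (Gamma1 𝔞) π)
  have _ := Fintype.ofFinite (HeckeIndex (Gamma1 𝔠) π)
  obtain ⟨hinj, j, r, hj, hjr⟩ := exists_bijective_heckeIndex hπ hle h𝔠
  have hsum := sum_change_transversal ρ hc
    (δ₁ := fun x : HeckeIndex (Gamma1 𝔞) π => cosetRep x)
    (δ₂ := fun x : HeckeIndex (Gamma1 𝔠) π => cosetRep x)
    (fun x => by rwa [det_cosetRep]) (fun x => by rwa [det_cosetRep])
    (fun x => by rw [det_cosetRep]; exact hπ.ne_zero) hinj hj hjr (i g) (MulAction.toPerm (i g)⁻¹)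
    (fun y => g⁻¹ • y) (h₁ := fun x => transfer (i g) x) (h₂ := fun y => i (transfer g y))
    (transfer_spec (i g)) (transfer_spec g)
  have hfix := apply_leftAction_of_mem_Gamma1 ρ hf (g := i g) (Gamma1_mono hle' g.2)
  -- The adjugate of a representative at level `𝔠` is `(1 *; 0 π)` modulo `𝔫`, so `f` sees it only
  -- through `χ(π)`.
  have hrep : ∀ (y : HeckeIndex (Gamma1 𝔠) π) (hu), ∀ v ∈ K,
      f (adjMul ρ (cosetRep y) hu v) = (χ hπ'.unit : k) * f v := by
    intro y hu v hv
    obtain ⟨h00, h10, h11⟩ := mk_apply_of_mem_Gamma1 (Gamma1_mono hle' y.out.2)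
    unfold adjMul
    have hadj : (cosetRep y).adjugate = !![mat y.out 1 1, -mat y.out 0 1;
        -(mat y.out 1 0 * π), mat y.out 0 0 * π] := by
      rw [cosetRep, mul_tildeMat, Matrix.adjugate_fin_two_of]
    rw [rightMul_eq ρ _ (x := hπ'.unit), hf _ _ v hv]
    · rw [hadj]
      exact h11
    · rw [hadj]
      change Ideal.Quotient.mk 𝔫 (-(mat y.out 1 0 * π)) = 0
      rw [map_neg, map_mul, h10, zero_mul, neg_zero]
    · rw [hadj]
      change Ideal.Quotient.mk 𝔫 (mat y.out 0 0 * π) = _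
      rw [map_mul, h00, one_mul]
      rfl
  have h1 := congrArg f hsum
  have hK' : ∀ x : HeckeIndex (Gamma1 𝔞) π, ∀ hu, ∀ v ∈ K, adjMul ρ (cosetRep x) hu v ∈ K :=
    fun x hu v hv => hK _ _ hv
  rw [map_add, map_sub, hfix _ (K.sum_mem fun x _ => hK' x _ _ (hcK _)), sub_self, add_zero,
    map_sum] at h1
  rw [heckeFun_trivial, finsum_eq_sum_of_fintype, Finset.mul_sum, heckeFun,
    finsum_eq_sum_of_fintype]
  refine Eq.trans h1.symm ?_
  exact Finset.sum_congr rfl fun y _ => hrep y _ _ (hcK _)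

end Restriction

/-! ### The class of the upper right entry -/

section Eisenstein

variable {R : Type} [CommRing R] {𝔠 𝔫 : Ideal R} {π : R} {k : Type} [CommRing k]

/-- The homomorphism `(a b; c d) ↦ τ(b)` on a congruence subgroup on which `a` and `d` are `1` under
the reduction `τ`. -/
def upperEntry (𝔠 : Ideal R) (τ : R →+* k) (g : Gamma1 𝔠) : k := τ (mat g 0 1)

theorem apply_of_mem_Gamma1 {τ : R →+* k} (hτ : 𝔠 ≤ RingHom.ker τ) (g : Gamma1 𝔠) :
    τ (mat g 0 0) = 1 ∧ τ (mat g 1 0) = 0 ∧ τ (mat g 1 1) = 1 := by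
  have h10 : τ (mat g 1 0) = 0 := hτ g.2.1
  have h11 : τ (mat g 1 1) = 1 := by
    have : τ (mat g 1 1 - 1) = 0 := hτ g.2.2
    rwa [map_sub, map_one, sub_eq_zero] at this
  refine ⟨?_, h10, h11⟩
  simpa [h10, h11] using congrArg τ (det_eq g)

theorem upperEntry_mul {τ : R →+* k} (hτ : 𝔠 ≤ RingHom.ker τ) (g h : Gamma1 𝔠) :
    upperEntry 𝔠 τ (g * h) = upperEntry 𝔠 τ h + upperEntry 𝔠 τ g := by
  simp only [upperEntry]
  rw [mat_mul, Matrix.mul_apply, Fin.sum_univ_two, map_add, map_mul, map_mul,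
    (apply_of_mem_Gamma1 hτ g).1, (apply_of_mem_Gamma1 hτ h).2.2, one_mul, mul_one]

theorem upperEntry_mem_cocycles₁ {τ : R →+* k} (hτ : 𝔠 ≤ RingHom.ker τ) :
    upperEntry 𝔠 τ ∈ groupCohomology.cocycles₁ (coeff (Gamma1 𝔠) (trivialRep 𝔫 k)) := by
  rw [groupCohomology.mem_cocycles₁_iff]
  exact upperEntry_mul hτ

/-- The class of `(a b; c d) ↦ τ(b)` is an eigenclass: up to the twist by `τ(π)⁻¹`, the operator
`T_π` acts on it by its degree. -/
theorem heckeFun_upperEntry {τ : R →+* k} (hτ : 𝔠 ≤ RingHom.ker τ)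
    [Finite (HeckeIndex (Gamma1 𝔠) π)] (hπ' : IsUnit (Ideal.Quotient.mk 𝔫 π)) (g : Gamma1 𝔠) :
    τ π * heckeFun (trivialRep 𝔫 k) hπ' (upperEntry 𝔠 τ) g =
      Nat.card (HeckeIndex (Gamma1 𝔠) π) * upperEntry 𝔠 τ g := by
  have _ := Fintype.ofFinite (HeckeIndex (Gamma1 𝔠) π)
  rw [heckeFun_trivial, finsum_eq_sum_of_fintype, Finset.mul_sum]
  -- Compare the upper right entries in `g γ_{g⁻¹x} = γ_x (transfer g x)`; the terms that depend
  -- on the representatives cancel in the sum over `x`.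
  have key : ∀ x : HeckeIndex (Gamma1 𝔠) π, τ π * upperEntry 𝔠 τ (transfer g x) =
      τ (mat (g⁻¹ • x).out 0 1) + upperEntry 𝔠 τ g - τ (mat x.out 0 1) := by
    intro x
    have h := congrArg (fun M : Matrix (Fin 2) (Fin 2) R => τ (M 0 1)) (transfer_spec g x)
    simp only [cosetRep, mul_tildeMat, Matrix.mul_apply, Fin.sum_univ_two] at h
    simp only [Matrix.of_apply, Matrix.cons_val', Matrix.cons_val_one, Matrix.cons_val_zero,
      Matrix.cons_val_fin_one, map_add, map_mul] at h
    rw [(apply_of_mem_Gamma1 hτ g).1, (apply_of_mem_Gamma1 hτ x.out).1,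
      (apply_of_mem_Gamma1 hτ (g⁻¹ • x).out).2.2, (apply_of_mem_Gamma1 hτ (transfer g x)).2.2] at h
    simp only [upperEntry]
    linear_combination -h
  simp only [key, Finset.sum_sub_distrib, Finset.sum_add_distrib]
  rw [Fintype.sum_equiv (MulAction.toPerm g⁻¹) (fun x : HeckeIndex (Gamma1 𝔠) π =>
    τ (mat (g⁻¹ • x).out 0 1)) (fun x => τ (mat x.out 0 1)) (fun x => rfl)]
  simp

end Eisenstein

/-! ### Functions on `GL₂(R/𝔫)` -/

section Induced

variable {R : Type} [CommRing R] {𝔞 𝔫 : Ideal R}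
  {k E : Type} [Field k] [AddCommGroup E] [Module k E]
  (ρ : Representation k (GL (Fin 2) (R ⧸ 𝔫))ᵐᵒᵖ E)

variable (𝔫 k) in
/-- The space of all functions on `GL₂(R/𝔫)`, as a right module: `(F · g)(z) = F(gz)`. -/
def funRep : Representation k (GL (Fin 2) (R ⧸ 𝔫))ᵐᵒᵖ (GL (Fin 2) (R ⧸ 𝔫) → k) where
  toFun g := LinearMap.funLeft k k (fun z => unop g * z)
  map_one' := by ext F z; simp [LinearMap.funLeft]
  map_mul' g h := by ext F z; simp [LinearMap.funLeft, mul_assoc]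

/-- The equivariant map `v ↦ (z ↦ f(v · z))` from a right module to the functions on `GL₂(R/𝔫)`
that belongs to a linear functional `f` (Frobenius reciprocity). -/
def toFunRep (f : E →ₗ[k] k) : E →ₗ[k] (GL (Fin 2) (R ⧸ 𝔫) → k) where
  toFun v z := f (ρ (op z) v)
  map_add' v w := by funext z; simp
  map_smul' a v := by funext z; simp

theorem toFunRep_apply (f : E →ₗ[k] k) (v : E) (z : GL (Fin 2) (R ⧸ 𝔫)) :
    toFunRep ρ f v z = f (ρ (op z) v) := rfl

theorem toFunRep_map (f : E →ₗ[k] k) (g : (GL (Fin 2) (R ⧸ 𝔫))ᵐᵒᵖ) (v : E) :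
    toFunRep ρ f (ρ g v) = funRep 𝔫 k g (toFunRep ρ f v) := by
  funext z
  change f (ρ (op z) (ρ g v)) = f (ρ (op (unop g * z)) v)
  rw [op_mul, op_unop, map_mul]
  rfl

theorem leftAction_eq (g : Gamma1 𝔞) (v : E) :
    leftAction ρ g v = ρ (op (Matrix.SpecialLinearGroup.toGL (redHom 𝔞 𝔫 g))⁻¹) v := rfl

theorem toFunRep_bd (f : E →ₗ[k] k) (v : E) (g : Gamma1 𝔞) :
    toFunRep ρ f (bd (Gamma1 𝔞) ρ v g) = bd (Gamma1 𝔞) (funRep 𝔫 k) (toFunRep ρ f v) g := by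
  change toFunRep ρ f (leftAction ρ g v - v) = _
  rw [map_sub, leftAction_eq, toFunRep_map]
  rfl

theorem exists_eq_toGL_mul_diagOne {A : Type} [CommRing A] (x : GL (Fin 2) A) :
    ∃ s : Matrix.SpecialLinearGroup (Fin 2) A,
      x = Matrix.SpecialLinearGroup.toGL s * diagOne (Matrix.GeneralLinearGroup.det x) := by
  have hdet : ∀ t : Aˣ, Matrix.GeneralLinearGroup.det (diagOne t) = t := by
    intro t
    apply Units.ext
    simp [diagOne]
  have h1 : Matrix.GeneralLinearGroup.det
      (x * (diagOne (Matrix.GeneralLinearGroup.det x))⁻¹) = 1 := by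
    rw [map_mul, map_inv, hdet, mul_inv_cancel]
  refine ⟨⟨(x * (diagOne (Matrix.GeneralLinearGroup.det x))⁻¹ : GL (Fin 2) A),
    congrArg Units.val h1⟩, ?_⟩
  rw [← mul_inv_eq_iff_eq_mul]
  exact Units.ext rfl

/-- Shapiro's lemma: a cocycle of `Γ₁(𝔞)` that is killed by the functional `f` on the kernel of the
reduction modulo `𝔫` becomes a coboundary in the functions on `GL₂(R/𝔫)`.
The condition on `diagOne` extends the statement from functions on `SL₂(R/𝔫)` to functions on
`GL₂(R/𝔫)`. -/
theorem exists_toFunRep_eq_bd {K : Submodule k E} (hK : ∀ g, ∀ v ∈ K, ρ g v ∈ K) {f : E →ₗ[k] k}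
    {χ : (R ⧸ 𝔫)ˣ →* kˣ}
    (hf : ∀ (x : (R ⧸ 𝔫)ˣ), ∀ v ∈ K, f (ρ (op (diagOne x)) v) = (χ x : k) * f v)
    {u : Gamma1 𝔞 → E} (hu : u ∈ groupCohomology.cocycles₁ (coeff (Gamma1 𝔞) ρ))
    (huK : ∀ g, u g ∈ K) (hred : Function.Surjective (redHom 𝔞 𝔫))
    (hker : ∀ h, redHom 𝔞 𝔫 h = 1 → f (u h) = 0) :
    ∃ F, ∀ g, toFunRep ρ f (u g) = bd (Gamma1 𝔞) (funRep 𝔫 k) F g := by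
  rw [groupCohomology.mem_cocycles₁_iff] at hu
  change ∀ g h : Gamma1 𝔞, u (g * h) = leftAction ρ g (u h) + u g at hu
  have hind : ∀ g h : Gamma1 𝔞, redHom 𝔞 𝔫 g = redHom 𝔞 𝔫 h → f (u g⁻¹) = f (u h⁻¹) := by
    intro g h hgh
    have h1 : redHom 𝔞 𝔫 (g⁻¹ * h) = 1 := by rw [map_mul, map_inv, hgh, inv_mul_cancel]
    have h2 : g⁻¹ = (g⁻¹ * h) * h⁻¹ := by rw [mul_inv_cancel_right]
    rw [h2, hu, map_add, hker _ h1, add_zero, leftAction_eq, h1, map_one, inv_one, op_one, map_one]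
    rfl
  choose s hs using exists_eq_toGL_mul_diagOne (A := R ⧸ 𝔫)
  choose γ hγ using hred
  -- Write `x = s · (1 0; 0 det x)` with `s ∈ SL₂` and lift `s` to `γ ∈ Γ₁(𝔞)`; the function is
  -- `F(x) = χ(det x) f(u(γ⁻¹))`, which does not depend on the lift.
  refine ⟨fun x => (χ (Matrix.GeneralLinearGroup.det x) : k) * f (u (γ (s x))⁻¹), fun g => ?_⟩
  funext x
  have hdet : Matrix.GeneralLinearGroup.det ((Matrix.SpecialLinearGroup.toGL (redHom 𝔞 𝔫 g))⁻¹ * x)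
      = Matrix.GeneralLinearGroup.det x := by
    rw [map_mul, map_inv]
    have : Matrix.GeneralLinearGroup.det (Matrix.SpecialLinearGroup.toGL (redHom 𝔞 𝔫 g)) = 1 :=
      Units.ext (Matrix.SpecialLinearGroup.det_coe _)
    rw [this, inv_one, one_mul]
  have hsx : s ((Matrix.SpecialLinearGroup.toGL (redHom 𝔞 𝔫 g))⁻¹ * x) =
      (redHom 𝔞 𝔫 g)⁻¹ * s x := by
    have h1 := hs ((Matrix.SpecialLinearGroup.toGL (redHom 𝔞 𝔫 g))⁻¹ * x)
    rw [hdet] at h1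
    conv_lhs at h1 => rw [hs x, ← mul_assoc]
    have h2 := mul_right_cancel h1
    apply Subtype.ext
    rw [← map_inv, ← map_mul] at h2
    rw [← map_inv Matrix.SpecialLinearGroup.toGL]
    exact congrArg Units.val h2.symm
  have hval : f (u (γ ((redHom 𝔞 𝔫 g)⁻¹ * s x))⁻¹) =
      f (leftAction ρ (γ (s x))⁻¹ (u g)) + f (u (γ (s x))⁻¹) := by
    rw [hind _ (g⁻¹ * γ (s x)) (by rw [hγ, map_mul, map_inv, hγ]), mul_inv_rev, inv_inv, hu,
      map_add]
    rfl
  change f (ρ (op x) (u g)) = (χ (Matrix.GeneralLinearGroup.det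
      ((Matrix.SpecialLinearGroup.toGL (redHom 𝔞 𝔫 g))⁻¹ * x)) : k) *
    f (u (γ (s ((Matrix.SpecialLinearGroup.toGL (redHom 𝔞 𝔫 g))⁻¹ * x)))⁻¹) -
      (χ (Matrix.GeneralLinearGroup.det x) : k) * f (u (γ (s x))⁻¹)
  rw [hdet, hsx, hval, mul_add, add_sub_cancel_right]
  have hL : leftAction ρ (γ (s x))⁻¹ (u g) =
      ρ (op (Matrix.SpecialLinearGroup.toGL (s x))) (u g) := by
    have := leftAction_eq ρ (γ (s x))⁻¹ (u g)
    rw [map_inv, hγ, map_inv, inv_inv] at this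
    exact this
  rw [hL, ← hf _ _ (hK _ _ (huK g))]
  conv_lhs => rw [hs x, op_mul, map_mul]
  rfl

/-- Multiplication by `(1 0; 0 t)` carries the coboundary of `v` to that of `v · (1 0; 0 t)` up to
a substitution of the argument, because `(1 0; 0 t)` normalises the image of `Γ₁(𝔞)` in
`GL₂(R/𝔫)`. The new argument `g'` depends neither on the module nor on `v`. -/
theorem exists_bd_diagOne (hred : Function.Surjective (redHom 𝔞 𝔫)) (t : (R ⧸ 𝔫)ˣ)
    (g : Gamma1 𝔞) : ∃ g' : Gamma1 𝔞, ∀ {X : Type} [AddCommGroup X] [Module k X]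
      (ρ : Representation k (GL (Fin 2) (R ⧸ 𝔫))ᵐᵒᵖ X) (v : X),
        bd (Gamma1 𝔞) ρ (ρ (op (diagOne t)) v) g = ρ (op (diagOne t)) (bd (Gamma1 𝔞) ρ v g') := by
  obtain ⟨s, hs⟩ := exists_eq_toGL_mul_diagOne
    (diagOne t * Matrix.SpecialLinearGroup.toGL (redHom 𝔞 𝔫 g) * (diagOne t)⁻¹)
  have hd : Matrix.GeneralLinearGroup.det
      (diagOne t * Matrix.SpecialLinearGroup.toGL (redHom 𝔞 𝔫 g) * (diagOne t)⁻¹) = 1 := by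
    rw [map_mul, map_mul, map_inv, mul_comm, inv_mul_cancel_left]
    exact Units.ext (Matrix.SpecialLinearGroup.det_coe _)
  rw [hd, map_one, mul_one] at hs
  obtain ⟨g', hg'⟩ := hred s
  refine ⟨g', fun {X} _ _ ρ v => ?_⟩
  change leftAction ρ g (ρ (op (diagOne t)) v) - ρ (op (diagOne t)) v =
    ρ (op (diagOne t)) (leftAction ρ g' v - v)
  rw [map_sub, leftAction_eq, leftAction_eq, hg', ← hs]
  congr 1
  rw [← Module.End.mul_apply, ← Module.End.mul_apply, ← map_mul, ← map_mul, ← op_mul, ← op_mul]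
  congr 3
  group

/-- The action of `γ_x^ι` for `γ_x = s π̃` is that of `(1 0; 0 π)` followed by that of `s`. -/
theorem iotaMul_eq {π : R} (hπ' : IsUnit (Ideal.Quotient.mk 𝔫 π)) (x : HeckeIndex (Gamma1 𝔞) π)
    (v : E) : iotaMul ρ hπ' x v = leftAction ρ x.out (ρ (op (diagOne hπ'.unit)) v) := by
  rw [leftAction_apply ρ _ (isUnit_mk_det_adjugate (isUnit_mk_det_mat x.out))]
  have hu : IsUnit (Ideal.Quotient.mk 𝔫 (tildeMat π).adjugate.det) := by
    refine isUnit_mk_det_adjugate ?_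
    rwa [det_tildeMat]
  have h1 : ρ (op (diagOne hπ'.unit)) v = rightMul ρ (tildeMat π).adjugate hu v := by
    unfold rightMul
    congr 3
    ext i j
    fin_cases i <;> fin_cases j <;> simp [diagOne, tildeMat, Matrix.adjugate_fin_two]
  rw [h1, ← rightMul_mul ρ _ _ _ _ (by
    rw [← Matrix.adjugate_mul_distrib]; exact isUnit_adjugate_cosetRep hπ' x)]
  unfold iotaMul
  congr 1
  simp only [cosetRep, Matrix.adjugate_mul_distrib]

theorem toFunRep_heckeFun {π : R} [Finite (HeckeIndex (Gamma1 𝔞) π)]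
    (hπ' : IsUnit (Ideal.Quotient.mk 𝔫 π)) (f : E →ₗ[k] k) (c : Gamma1 𝔞 → E) (g : Gamma1 𝔞) :
    toFunRep ρ f (heckeFun ρ hπ' c g) =
      heckeFun (funRep 𝔫 k) hπ' (fun h => toFunRep ρ f (c h)) g := by
  have _ := Fintype.ofFinite (HeckeIndex (Gamma1 𝔞) π)
  simp only [heckeFun, finsum_eq_sum_of_fintype, map_sum]
  exact Finset.sum_congr rfl fun x _ => toFunRep_map ρ f _ _

end Induced

/-! ### Eigenclasses that become trivial in the functions on `GL₂(R/𝔫)` -/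

section EisensteinSystem

variable {R : Type} [CommRing R] {𝔞 𝔫 : Ideal R} {ℓ : ℕ} [Fact ℓ.Prime]
  {E : Type} [AddCommGroup E] [Module (ZMod ℓ) E]
  (ρ : Representation (ZMod ℓ) (GL (Fin 2) (R ⧸ 𝔫))ᵐᵒᵖ E)

/-- Let `u` be a cocycle with values in `K` that becomes the coboundary of `F` in the functions on
`GL₂(R/𝔫)`. If `u` is an eigenclass that cannot be moved by a coboundary into the kernel of the map
to these functions, then its eigenvalues are the degrees of the Hecke operators, up to a character
of the determinant. Indeed `F` is then an eigenvector in a quotient of the functions on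
`GL₂(R/𝔫)` on which `T_π` acts as its degree times `(1 0; 0 π)`. -/
theorem exists_character_of_toFunRep_eq_bd (e : (R ⧸ 𝔫) ≃+* ZMod ℓ × ZMod ℓ)
    {K : Submodule (ZMod ℓ) E}
    (hK : ∀ g, ∀ v ∈ K, ρ g v ∈ K) {f : E →ₗ[ZMod ℓ] ZMod ℓ} {u : Gamma1 𝔞 → E}
    (huK : ∀ g, u g ∈ K) (hred : Function.Surjective (redHom 𝔞 𝔫))
    {F : GL (Fin 2) (R ⧸ 𝔫) → ZMod ℓ}
    (hF : ∀ g, toFunRep ρ f (u g) = bd (Gamma1 𝔞) (funRep 𝔫 (ZMod ℓ)) F g)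
    {P : Type} {p : P → R} (hp : ∀ i, IsUnit (Ideal.Quotient.mk 𝔫 (p i)))
    [∀ i, Finite (HeckeIndex (Gamma1 𝔞) (p i))] {μ : P → ZMod ℓ}
    (hμ : ∀ i, heckeFun ρ (hp i) u - μ i • u ∈
      groupCohomology.coboundaries₁ (coeff (Gamma1 𝔞) ρ))
    (hmin : ∀ v : E, (∀ g, u g - bd (Gamma1 𝔞) ρ v g ∈ K) →
      ¬ ∀ g, toFunRep ρ f (u g - bd (Gamma1 𝔞) ρ v g) = 0) :
    ∃ χ : (R ⧸ 𝔫)ˣ →* (ZMod ℓ)ˣ, ∀ i,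
      μ i = Nat.card (HeckeIndex (Gamma1 𝔞) (p i)) * (χ (hp i).unit : ZMod ℓ) := by
  have : Finite (R ⧸ 𝔫) := Finite.of_equiv _ e.symm.toEquiv
  have : Finite (GL (Fin 2) (R ⧸ 𝔫)) := inferInstance
  let I := GL (Fin 2) (R ⧸ 𝔫) → ZMod ℓ
  -- The functions whose coboundary comes from a `K`-valued coboundary in `E`.
  let Y : Submodule (ZMod ℓ) I :=
    { carrier := {G | ∃ v : E, (∀ g, bd (Gamma1 𝔞) ρ v g ∈ K) ∧
        ∀ g, bd (Gamma1 𝔞) (funRep 𝔫 (ZMod ℓ)) G g = toFunRep ρ f (bd (Gamma1 𝔞) ρ v g)}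
      add_mem' := by
        rintro G G' ⟨v, hv, hv'⟩ ⟨w, hw, hw'⟩
        refine ⟨v + w, fun g => ?_, fun g => ?_⟩
        · rw [map_add]; exact K.add_mem (hv g) (hw g)
        · rw [map_add, map_add, Pi.add_apply, Pi.add_apply, map_add, hv', hw']
      zero_mem' := ⟨0, fun g => by rw [map_zero]; exact K.zero_mem, fun g => by
        rw [map_zero, map_zero, Pi.zero_apply, Pi.zero_apply, map_zero]⟩
      smul_mem' := by
        rintro a G ⟨v, hv, hv'⟩
        refine ⟨a • v, fun g => ?_, fun g => ?_⟩
        · rw [map_smul]; exact K.smul_mem _ (hv g)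
        · rw [map_smul, map_smul, Pi.smul_apply, Pi.smul_apply, map_smul, hv'] }
  have hYK : ∀ v ∈ K, toFunRep ρ f v ∈ Y := fun v hv =>
    ⟨v, fun g => K.sub_mem (leftAction_mem ρ hK _ hv) hv, fun g => (toFunRep_bd ρ f v g).symm⟩
  have hFY : F ∉ Y := by
    rintro ⟨v, hv, hv'⟩
    refine hmin v (fun g => K.sub_mem (huK g) (hv g)) fun g => ?_
    rw [map_sub, hF, hv', sub_self]
  -- The action of the torus `(1 0; 0 t)`, which preserves `Y`.
  let D : (R ⧸ 𝔫)ˣ →* Module.End (ZMod ℓ) I :=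
    { toFun := fun t => funRep 𝔫 (ZMod ℓ) (op (diagOne t))
      map_one' := by rw [map_one, op_one, map_one]
      map_mul' := fun s t => by rw [mul_comm s t, map_mul, op_mul, map_mul] }
  have hDY : ∀ t, ∀ G ∈ Y, D t G ∈ Y := by
    rintro t G ⟨v, hv, hv'⟩
    refine ⟨ρ (op (diagOne t)) v, fun g => ?_, fun g => ?_⟩ <;>
    obtain ⟨g', hg'⟩ := exists_bd_diagOne (k := ZMod ℓ) hred t g
    · rw [hg']; exact hK _ _ (hv g')
    · rw [hg' ρ, toFunRep_map, ← hv']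
      exact hg' (funRep 𝔫 (ZMod ℓ)) G
  -- Modulo `Y`, every summand of `T_π` acts on `F` as `(1 0; 0 π)`, since the coboundary of `F` is
  -- the image of a `K`-valued cocycle.
  have hiota : ∀ i (x : HeckeIndex (Gamma1 𝔞) (p i)),
      iotaMul (funRep 𝔫 (ZMod ℓ)) (hp i) x F - D (hp i).unit F ∈ Y := by
    intro i x
    obtain ⟨g', hg'⟩ := exists_bd_diagOne (k := ZMod ℓ) hred (hp i).unit x.out
    have h1 : iotaMul (funRep 𝔫 (ZMod ℓ)) (hp i) x F - D (hp i).unit F =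
        bd (Gamma1 𝔞) (funRep 𝔫 (ZMod ℓ)) (funRep 𝔫 (ZMod ℓ) (op (diagOne (hp i).unit)) F)
          x.out := by
      rw [iotaMul_eq]; rfl
    rw [h1, hg', ← hF, ← toFunRep_map]
    exact hYK _ (hK _ _ (huK g'))
  have hcard : ∀ i, heckeVec (Γ := Gamma1 𝔞) (funRep 𝔫 (ZMod ℓ)) (hp i) F -
      (Nat.card (HeckeIndex (Gamma1 𝔞) (p i)) : ZMod ℓ) • D (hp i).unit F ∈ Y := by
    intro i
    have _ := Fintype.ofFinite (HeckeIndex (Gamma1 𝔞) (p i))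
    have : heckeVec (Γ := Gamma1 𝔞) (funRep 𝔫 (ZMod ℓ)) (hp i) F -
        (Nat.card (HeckeIndex (Gamma1 𝔞) (p i)) : ZMod ℓ) • D (hp i).unit F =
        ∑ x : HeckeIndex (Gamma1 𝔞) (p i),
          (iotaMul (funRep 𝔫 (ZMod ℓ)) (hp i) x F - D (hp i).unit F) := by
      rw [Finset.sum_sub_distrib, heckeVec, finsum_eq_sum_of_fintype, Finset.sum_const,
        Finset.card_univ, Nat.card_eq_fintype_card, Nat.cast_smul_eq_nsmul]
    rw [this]
    exact Y.sum_mem fun x _ => hiota i x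
  have heig : ∀ i, heckeVec (Γ := Gamma1 𝔞) (funRep 𝔫 (ZMod ℓ)) (hp i) F - μ i • F ∈ Y := by
    intro i
    obtain ⟨v, hv⟩ := (mem_coboundaries₁_iff ρ).mp (hμ i)
    refine ⟨v, fun g => ?_, fun g => ?_⟩
    · rw [hv]
      exact K.sub_mem (heckeFun_mem ρ hK (hp i) huK g) (K.smul_mem _ (huK g))
    · rw [hv, map_sub, ← heckeFun_bd, map_smul]
      change _ = toFunRep ρ f (heckeFun ρ (hp i) u g - μ i • u g)
      rw [map_sub, map_smul, hF, toFunRep_heckeFun]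
      simp only [hF]
      rfl
  have hkey : ∀ i, (Nat.card (HeckeIndex (Gamma1 𝔞) (p i)) : ZMod ℓ) • D (hp i).unit F -
      μ i • F ∈ Y := by
    intro i
    have := Y.sub_mem (heig i) (hcard i)
    rwa [sub_sub_sub_cancel_left] at this
  let Dbar : (R ⧸ 𝔫)ˣ →* Module.End (ZMod ℓ) (I ⧸ Y) :=
    { toFun := fun t => Y.mapQ Y (D t) (hDY t)
      map_one' := by
        ext x; simp
      map_mul' := fun s t => by
        ext x; simp }
  have hDbar : ∀ t G, Dbar t (Submodule.Quotient.mk G) = Submodule.Quotient.mk (D t G) :=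
    fun t G => rfl
  -- The torus acts on the solutions in `I ⧸ Y` of the equations that `F` satisfies, and has an
  -- eigenvector there.
  let S : Submodule (ZMod ℓ) (I ⧸ Y) :=
    { carrier := {q | ∀ i, (Nat.card (HeckeIndex (Gamma1 𝔞) (p i)) : ZMod ℓ) • Dbar (hp i).unit q =
        μ i • q}
      add_mem' := fun {q r} hq hr i => by rw [map_add, smul_add, hq, hr, smul_add]
      zero_mem' := fun i => by simp
      smul_mem' := fun a q hq i => by rw [map_smul, smul_comm, hq, smul_comm] }
  have hS : ∀ t, ∀ q ∈ S, Dbar t q ∈ S := by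
    intro t q hq i
    rw [← Module.End.mul_apply, ← map_mul, mul_comm, map_mul, Module.End.mul_apply, ← map_smul,
      hq i, map_smul]
  have hS0 : S ≠ ⊥ := by
    intro h
    have hmem : (Submodule.Quotient.mk F : I ⧸ Y) ∈ S := by
      intro i
      rw [hDbar, ← Submodule.Quotient.mk_smul, ← Submodule.Quotient.mk_smul]
      exact (Submodule.Quotient.eq Y).mpr (hkey i)
    rw [h, Submodule.mem_bot, Submodule.Quotient.mk_eq_zero] at hmem
    exact hFY hmem
  obtain ⟨q, hq, hq0, χ, hχ⟩ := exists_character_eigenvector (units_pow_eq_one e) Dbar hS hS0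
  refine ⟨χ, fun i => smul_left_injective _ hq0 ?_⟩
  change μ i • q = (_ * _) • q
  rw [← hq i, hχ, smul_smul]

end EisensteinSystem

/-! ### The eigencocycle at level `𝔞𝔫` -/

section Main

variable {R : Type} [CommRing R] [IsDedekindDomain R] [Ring.HasFiniteQuotients R]
  {ℓ : ℕ} [Fact ℓ.Prime] {𝔞 𝔫 : Ideal R}
  {E : Type} [AddCommGroup E] [Module (ZMod ℓ) E]

/-- The Hecke operator on all cochains, as a linear map. -/
def heckeLin {Γ : Subgroup (Matrix.SpecialLinearGroup (Fin 2) R)} {π : R}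
    [Finite (HeckeIndex Γ π)] (ρ : Representation (ZMod ℓ) (GL (Fin 2) (R ⧸ 𝔫))ᵐᵒᵖ E)
    (hπ' : IsUnit (Ideal.Quotient.mk 𝔫 π)) : Module.End (ZMod ℓ) (Γ → E) where
  toFun := heckeFun ρ hπ'
  map_add' := heckeFun_add ρ hπ'
  map_smul' := heckeFun_smul ρ hπ'

variable (𝔫) in
omit [IsDedekindDomain R] [Ring.HasFiniteQuotients R] in
theorem bd_trivialRep (Γ : Subgroup (Matrix.SpecialLinearGroup (Fin 2) R)) (v : ZMod ℓ) :
    bd Γ (trivialRep 𝔫 (ZMod ℓ)) v = 0 := by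
  funext g
  exact sub_self v

omit [IsDedekindDomain R] [Ring.HasFiniteQuotients R] in
/-- `exists_semiinvariant` for a stable subspace `K`, with the functional extended to the whole
space. -/
theorem exists_semiinvariant_on (e : (R ⧸ 𝔫) ≃+* ZMod ℓ × ZMod ℓ) [FiniteDimensional (ZMod ℓ) E]
    (ρ : Representation (ZMod ℓ) (GL (Fin 2) (R ⧸ 𝔫))ᵐᵒᵖ E) {K : Submodule (ZMod ℓ) E}
    (hK : ∀ g, ∀ v ∈ K, ρ g v ∈ K) (hK0 : K ≠ ⊥) :
    ∃ f : E →ₗ[ZMod ℓ] ZMod ℓ, (∃ v ∈ K, f v ≠ 0) ∧ ∃ χ : (R ⧸ 𝔫)ˣ →* (ZMod ℓ)ˣ,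
      ∀ (x : (R ⧸ 𝔫)ˣ) (y : R ⧸ 𝔫), ∀ v ∈ K,
        f (ρ (op (diagOne x * unipotent (Multiplicative.ofAdd y))) v) = (χ x : ZMod ℓ) * f v := by
  let ρK : Subrepresentation ρ := ⟨K, fun g v hv => hK g v hv⟩
  have : Nontrivial K := Submodule.nontrivial_iff_ne_bot.mpr hK0
  obtain ⟨f₀, hf₀, χ, hχ⟩ := exists_semiinvariant e (X := K) ρK.toRepresentation
  obtain ⟨f, hf⟩ := LinearMap.exists_extend f₀
  have hff : ∀ v : K, f v = f₀ v := fun v => congrArg (fun h => h v) hf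
  refine ⟨f, ?_, χ, fun x y v hv => ?_⟩
  · by_contra! h
    exact hf₀ (LinearMap.ext fun v => by rw [← hff, h v v.2]; rfl)
  · have := hχ x y ⟨v, hv⟩
    rw [← hff, ← hff] at this
    exact this

/-- A cocycle at level `𝔞` that is an eigenclass in `H¹(Γ₁(𝔞), E)` gives rise to a cocycle with
trivial coefficients at level `𝔞𝔫` that is an honest eigenvector, with the same eigenvalues up to a
twist. -/
theorem exists_eigencocycle (e : (R ⧸ 𝔫) ≃+* ZMod ℓ × ZMod ℓ) {τ₁ τ₂ : R →+* ZMod ℓ}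
    (he : ∀ r, e (Ideal.Quotient.mk 𝔫 r) = (τ₁ r, τ₂ r)) (h𝔞 : IsCoprime 𝔞 𝔫)
    [FiniteDimensional (ZMod ℓ) E] (ρ : Representation (ZMod ℓ) (GL (Fin 2) (R ⧸ 𝔫))ᵐᵒᵖ E)
    {P : Type} {p : P → R} (hprime : ∀ i, Prime (p i))
    (hp : ∀ i, IsUnit (Ideal.Quotient.mk 𝔫 (p i)))
    {μ : P → ZMod ℓ} {u₀ : Gamma1 𝔞 → E}
    (hu₀ : u₀ ∈ groupCohomology.cocycles₁ (coeff (Gamma1 𝔞) ρ))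
    (hu₀' : u₀ ∉ groupCohomology.coboundaries₁ (coeff (Gamma1 𝔞) ρ))
    (hμ₀ : ∀ i, heckeFun ρ (hp i) u₀ - μ i • u₀ ∈
      groupCohomology.coboundaries₁ (coeff (Gamma1 𝔞) ρ)) :
    ∃ a b : ℕ, a ≤ ℓ - 2 ∧ b ≤ ℓ - 2 ∧
      ∃ w ∈ groupCohomology.cocycles₁ (coeff (Gamma1 (𝔞 * 𝔫)) (trivialRep 𝔫 (ZMod ℓ))), w ≠ 0 ∧
        ∃ ν : P → ZMod ℓ, (∀ i, heckeFun (trivialRep 𝔫 (ZMod ℓ)) (hp i) w = ν i • w) ∧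
          ∀ i, μ i = τ₁ (p i) ^ a * τ₂ (p i) ^ b * ν i := by
  have hfin : ∀ (𝔟 : Ideal R) i, Finite (HeckeIndex (Gamma1 𝔟) (p i)) := fun 𝔟 i =>
    finite_heckeIndex 𝔟 (hprime i).ne_zero
  have hle : 𝔞 * 𝔫 ≤ 𝔞 := Ideal.mul_le_left
  have hle' : 𝔞 * 𝔫 ≤ 𝔫 := Ideal.mul_le_right
  -- The primes `p i` do not divide `𝔫`.
  have h𝔠 : ∀ i, 𝔞 * 𝔫 ≤ Ideal.span {p i} → 𝔞 ≤ Ideal.span {p i} := by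
    intro i h
    have hpi : (Ideal.span {p i}).IsPrime :=
      (Ideal.span_singleton_prime (hprime i).ne_zero).mpr (hprime i)
    refine (hpi.mul_le.mp h).resolve_right fun h𝔫 => hpi.ne_top ?_
    obtain ⟨y, hy⟩ := (hp i).exists_right_inv
    obtain ⟨r, rfl⟩ := Ideal.Quotient.mk_surjective y
    rw [← map_mul, ← map_one (Ideal.Quotient.mk 𝔫), Ideal.Quotient.eq] at hy
    have h1 := (Ideal.span {p i}).sub_mem
      (Ideal.mul_mem_right r _ (Ideal.mem_span_singleton_self (p i))) (h𝔫 hy)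
    rw [sub_sub_cancel] at h1
    exact (Ideal.eq_top_iff_one _).mpr h1
  have hred := redHom_surjective e h𝔞
  have hunit : ∀ i, ((hp i).unit : R ⧸ 𝔫) = Ideal.Quotient.mk 𝔫 (p i) := fun i => rfl
  -- A minimal stable subspace in which the given system of eigenvalues occurs.
  obtain ⟨K, ⟨hK, u, hu, huK, hu', hμ⟩, hmin⟩ := exists_minimal_of_wellFoundedLT
    (fun K : Submodule (ZMod ℓ) E => (∀ g, ∀ v ∈ K, ρ g v ∈ K) ∧ ∃ u : Gamma1 𝔞 → E,
      u ∈ groupCohomology.cocycles₁ (coeff (Gamma1 𝔞) ρ) ∧ (∀ g, u g ∈ K) ∧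
      u ∉ groupCohomology.coboundaries₁ (coeff (Gamma1 𝔞) ρ) ∧
      ∀ i, heckeFun ρ (hp i) u - μ i • u ∈ groupCohomology.coboundaries₁ (coeff (Gamma1 𝔞) ρ))
    ⟨⊤, by simp, u₀, hu₀, by simp, hu₀', hμ₀⟩
  have hK0 : K ≠ ⊥ := by
    rintro rfl
    have : u = 0 := funext fun g => (Submodule.mem_bot (ZMod ℓ)).mp (huK g)
    exact hu' (this ▸ Submodule.zero_mem _)
  have hshift : ∀ (c : Gamma1 𝔞 → E) w i,
      heckeFun ρ (hp i) c - μ i • c ∈ groupCohomology.coboundaries₁ (coeff (Gamma1 𝔞) ρ) →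
      heckeFun ρ (hp i) (c - bd (Gamma1 𝔞) ρ w) - μ i • (c - bd (Gamma1 𝔞) ρ w) ∈
        groupCohomology.coboundaries₁ (coeff (Gamma1 𝔞) ρ) := by
    intro c w i h
    have h1 : heckeFun ρ (hp i) (c - bd (Gamma1 𝔞) ρ w) - μ i • (c - bd (Gamma1 𝔞) ρ w) =
        (heckeFun ρ (hp i) c - μ i • c) -
          (bd (Gamma1 𝔞) ρ (heckeVec (Γ := Gamma1 𝔞) ρ (hp i) w) - μ i • bd (Gamma1 𝔞) ρ w) := by
      rw [heckeFun_sub, heckeFun_bd, smul_sub]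
      abel
    rw [h1]
    exact Submodule.sub_mem _ h (Submodule.sub_mem _ ⟨_, rfl⟩ (Submodule.smul_mem _ _ ⟨_, rfl⟩))
  obtain ⟨f, ⟨v₀, hv₀, hfv₀⟩, χ, hf⟩ := exists_semiinvariant_on e ρ hK hK0
  -- By minimality, no such eigenclass takes values in the stable subspace of the `v ∈ K` with
  -- `f(v · g) = 0` for all `g`, which is proper as `f` is non-zero on `K`.
  have hmin' : ∀ c ∈ groupCohomology.cocycles₁ (coeff (Gamma1 𝔞) ρ),
      c ∉ groupCohomology.coboundaries₁ (coeff (Gamma1 𝔞) ρ) →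
      (∀ i, heckeFun ρ (hp i) c - μ i • c ∈ groupCohomology.coboundaries₁ (coeff (Gamma1 𝔞) ρ)) →
      (∀ g, c g ∈ K) → ¬ ∀ g, toFunRep ρ f (c g) = 0 := by
    intro c hc hc' hcμ hcK h0
    have hK1 : K ≤ K ⊓ LinearMap.ker (toFunRep ρ f) := by
      refine hmin ⟨fun g v hv => ⟨hK g v hv.1, ?_⟩, c, hc, fun g => ⟨hcK g, h0 g⟩, hc', hcμ⟩
        inf_le_left
      change toFunRep ρ f (ρ g v) = 0
      have : toFunRep ρ f v = 0 := hv.2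
      rw [toFunRep_map, this, map_zero]
    have h1 : toFunRep ρ f v₀ = 0 := (hK1 hv₀).2
    refine hfv₀ ?_
    have h2 := congrFun h1 1
    rw [toFunRep_apply, op_one, map_one] at h2
    exact h2
  let ι := Subgroup.inclusion (Gamma1_mono hle)
  let res : (Gamma1 𝔞 → E) →ₗ[ZMod ℓ] (Gamma1 (𝔞 * 𝔫) → ZMod ℓ) :=
    { toFun := fun c h => f (c (ι h))
      map_add' := fun c d => by funext h; simp
      map_smul' := fun a c => by funext h; simp }
  have hres : ∀ i c, c ∈ groupCohomology.cocycles₁ (coeff (Gamma1 𝔞) ρ) → (∀ g, c g ∈ K) →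
      heckeFun (trivialRep 𝔫 (ZMod ℓ)) (hp i) (res c) =
        ((χ (hp i).unit)⁻¹ : (ZMod ℓ)ˣ).val • res (heckeFun ρ (hp i) c) := by
    intro i c hc hcK
    funext g
    have := apply_heckeFun ρ hK hf hc hcK (hprime i) (hp i) hle hle' (h𝔠 i) g
    change _ = ((χ (hp i).unit)⁻¹ : (ZMod ℓ)ˣ).val * f (heckeFun ρ (hp i) c (ι g))
    rw [this, Units.inv_mul_cancel_left]
    rfl
  -- The coboundaries in `E` that take values in `K`; a vector with coboundary in `BK` need not be
  -- in `K`.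
  let BK : Submodule (ZMod ℓ) (Gamma1 𝔞 → E) :=
    { carrier := {c | c ∈ LinearMap.range (bd (Gamma1 𝔞) ρ) ∧ ∀ g, c g ∈ K}
      add_mem' := fun hc hd => ⟨add_mem hc.1 hd.1, fun g => K.add_mem (hc.2 g) (hd.2 g)⟩
      zero_mem' := ⟨zero_mem _, fun g => K.zero_mem⟩
      smul_mem' := fun a c hc => ⟨Submodule.smul_mem _ a hc.1, fun g => K.smul_mem a (hc.2 g)⟩ }
  have hBKle : BK ≤ LinearMap.range (bd (Gamma1 𝔞) ρ) := fun c hc => hc.1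
  have : FiniteDimensional (ZMod ℓ) BK := Submodule.finiteDimensional_of_le hBKle
  have hBKcoc : ∀ c ∈ BK, c ∈ groupCohomology.cocycles₁ (coeff (Gamma1 𝔞) ρ) := by
    rintro c ⟨⟨v, rfl⟩, -⟩
    exact bd_mem_cocycles₁ ρ v
  by_cases hu_res : res u ∈ BK.map res
  · -- The class `u` dies at level `𝔞𝔫`: the system of eigenvalues is that of an Eisenstein class.
    obtain ⟨c, ⟨⟨v, rfl⟩, hvK⟩, hcu⟩ := hu_res
    set u' := u - bd (Gamma1 𝔞) ρ v with hu'_def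
    have hu'K : ∀ g, u' g ∈ K := fun g => K.sub_mem (huK g) (hvK g)
    have hu'coc : u' ∈ groupCohomology.cocycles₁ (coeff (Gamma1 𝔞) ρ) :=
      Submodule.sub_mem _ hu (bd_mem_cocycles₁ ρ v)
    have hu'μ : ∀ i, heckeFun ρ (hp i) u' - μ i • u' ∈
        groupCohomology.coboundaries₁ (coeff (Gamma1 𝔞) ρ) := fun i => hshift u v i (hμ i)
    have hu'' : ∀ w, u' - bd (Gamma1 𝔞) ρ w ∉
        groupCohomology.coboundaries₁ (coeff (Gamma1 𝔞) ρ) := by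
      intro w h
      have h1 : u = (u' - bd (Gamma1 𝔞) ρ w) + bd (Gamma1 𝔞) ρ w + bd (Gamma1 𝔞) ρ v := by
        rw [hu'_def]; abel
      refine hu' (h1 ▸ ?_)
      exact Submodule.add_mem _ (Submodule.add_mem _ h ⟨w, rfl⟩) ⟨v, rfl⟩
    have hker : ∀ h, redHom 𝔞 𝔫 h = 1 → f (u' h) = 0 := by
      intro h hh
      have hent : ∀ i j, Ideal.Quotient.mk 𝔫 (mat h i j) =
          (1 : Matrix (Fin 2) (Fin 2) (R ⧸ 𝔫)) i j := fun i j =>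
        congrArg (fun s : Matrix.SpecialLinearGroup (Fin 2) (R ⧸ 𝔫) => s i j) hh
      have hmem : (h : Matrix.SpecialLinearGroup (Fin 2) R) ∈ Gamma1 (𝔞 * 𝔫) := by
        rw [Ideal.mul_eq_inf_of_coprime h𝔞.sup_eq]
        refine ⟨⟨h.2.1, ?_⟩, ⟨h.2.2, ?_⟩⟩
        · exact Ideal.Quotient.eq_zero_iff_mem.mp (by simpa using hent 1 0)
        · refine Ideal.Quotient.eq.mp ?_
          rw [map_one]
          simpa using hent 1 1
      have h2 : res u' = 0 := by rw [hu'_def, map_sub, hcu, sub_self]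
      exact congrFun h2 ⟨h, hmem⟩
    obtain ⟨F, hF⟩ := exists_toFunRep_eq_bd ρ hK (χ := χ) (f := f) (fun x v hv => by
      have := hf x 0 v hv
      rwa [ofAdd_zero, map_one, mul_one] at this) hu'coc hu'K hred hker
    obtain ⟨ψ, hψ⟩ := exists_character_of_toFunRep_eq_bd ρ e hK hu'K hred hF hp hu'μ
      (fun w hw => hmin' (u' - bd (Gamma1 𝔞) ρ w)
        (Submodule.sub_mem _ hu'coc (bd_mem_cocycles₁ ρ w))
        (hu'' w) (fun i => hshift u' w i (hu'μ i)) hw)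
    obtain ⟨a, ha, b, hb, hab⟩ := exists_pow_mul_pow_of_hom e
      (ψ * Units.map ((RingHom.fst (ZMod ℓ) (ZMod ℓ)).comp e.toRingHom).toMonoidHom)
    have hτ : 𝔞 * 𝔫 ≤ RingHom.ker τ₁ := by
      refine hle'.trans fun r hr => ?_
      have h1 := he r
      rw [Ideal.Quotient.eq_zero_iff_mem.mpr hr, map_zero] at h1
      exact (congrArg Prod.fst h1).symm
    have hτ0 : ∀ i, τ₁ (p i) ≠ 0 := by
      intro i
      have h1 := ((hp i).map e).map (RingHom.fst (ZMod ℓ) (ZMod ℓ))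
      rw [he] at h1
      exact h1.ne_zero
    have hcard : ∀ i, Nat.card (HeckeIndex (Gamma1 𝔞) (p i)) =
        Nat.card (HeckeIndex (Gamma1 (𝔞 * 𝔫)) (p i)) := by
      intro i
      obtain ⟨-, j, -, hj, -⟩ := exists_bijective_heckeIndex (hprime i) hle (h𝔠 i)
      exact Nat.card_eq_of_bijective j hj
    refine ⟨a, b, ha, hb, upperEntry (𝔞 * 𝔫) τ₁, upperEntry_mem_cocycles₁ hτ, fun h => ?_,
      fun i => Nat.card (HeckeIndex (Gamma1 (𝔞 * 𝔫)) (p i)) * (τ₁ (p i))⁻¹,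
      fun i => ?_, fun i => ?_⟩
    · have h1 : τ₁ 1 = 0 := congrFun h ⟨upper 1, upper_mem_Gamma1 _ _⟩
      simp at h1
    · funext g
      refine mul_left_cancel₀ (hτ0 i) ?_
      rw [heckeFun_upperEntry hτ (hp i) g, Pi.smul_apply, smul_eq_mul]
      have := hτ0 i
      field_simp
    · have h1 : (ψ (hp i).unit : ZMod ℓ) * (e (hp i).unit).1 =
          (e (hp i).unit).1 ^ a * (e (hp i).unit).2 ^ b := hab (hp i).unit
      rw [hunit, he] at h1
      have := hτ0 i
      rw [hψ i, hcard i, mul_left_comm, ← h1, mul_inv_cancel_right₀ this]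
  · -- The class `u` survives at level `𝔞𝔫`.
    obtain ⟨a, ha, b, hb, hab⟩ := exists_pow_mul_pow_of_hom e χ
    let Z := groupCohomology.cocycles₁ (coeff (Gamma1 (𝔞 * 𝔫)) (trivialRep 𝔫 (ZMod ℓ)))
    have hresZ : ∀ c ∈ groupCohomology.cocycles₁ (coeff (Gamma1 𝔞) ρ), (∀ g, c g ∈ K) →
        res c ∈ Z := by
      intro c hc hcK
      rw [groupCohomology.mem_cocycles₁_iff] at hc ⊢
      intro g h
      change f (c (ι g * ι h)) = f (c (ι h)) + f (c (ι g))
      rw [hc, map_add]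
      congr 1
      exact apply_leftAction_of_mem_Gamma1 ρ hf (g := ι g) (Gamma1_mono hle' g.2) _ (hcK _)
    obtain ⟨w, hwZ, hw0, hw⟩ := exists_eigenvector_of_quotient (V := Gamma1 (𝔞 * 𝔫) → ZMod ℓ)
      (T := fun i => heckeLin (trivialRep 𝔫 (ZMod ℓ)) (hp i))
      (μ := fun i => ((χ (hp i).unit)⁻¹ : (ZMod ℓ)ˣ).val * μ i) (Z := Z) (N := BK.map res)
      (fun i j z hz => heckeFun_comm (hprime i) (hprime j) (hp i) (hp j) hz)
      (by rintro _ ⟨c, hc, rfl⟩; exact hresZ c (hBKcoc c hc) hc.2)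
      (by
        rintro i _ ⟨c, hc, rfl⟩
        change heckeFun _ (hp i) (res c) ∈ _
        rw [hres i c (hBKcoc c hc) hc.2]
        refine Submodule.smul_mem _ _ ⟨_, ⟨?_, heckeFun_mem ρ hK (hp i) hc.2⟩, rfl⟩
        obtain ⟨⟨v, rfl⟩, -⟩ := hc
        exact ⟨_, (heckeFun_bd ρ (hp i) v).symm⟩)
      (hresZ u hu huK) hu_res
      (by
        intro i
        change heckeFun _ (hp i) (res u) - _ ∈ _
        rw [hres i u hu huK, mul_smul, ← smul_sub, ← map_smul, ← map_sub]
        exact Submodule.smul_mem _ _ ⟨_, ⟨hμ i, fun g =>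
          K.sub_mem (heckeFun_mem ρ hK (hp i) huK g) (K.smul_mem _ (huK g))⟩, rfl⟩)
    refine ⟨a, b, ha, hb, w, hwZ, hw0, _, hw, fun i => ?_⟩
    have := hab (hp i).unit
    rw [hunit, he] at this
    rw [← this, Units.mul_inv_cancel_left]

end Main

/-! ### Systems of eigenvalues -/

section Systems

variable {K : Type} [Field K] [NumberField K] {ℓ : ℕ} [Fact ℓ.Prime]
  {E : Type} [AddCommGroup E] [Module (ZMod ℓ) E] {𝔟 : Ideal (𝓞 K)}
  {ρ : Representation (ZMod ℓ) (GL (Fin 2) (𝓞 K ⧸ Ideal.span {(ℓ : 𝓞 K)}))ᵐᵒᵖ E}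

/-- A common eigenvector of the operators `T_π` defines a system of eigenvalues of the Hecke
algebra. -/
theorem exists_occurs {v : H1 (Gamma1 𝔟) ρ} (hv : v ≠ 0) {μ : PrimeAway K ℓ → ZMod ℓ}
    (hμ : ∀ π, T 𝔟 ρ π v = μ π • v) :
    ∃ Ψ : heckeAlgebra 𝔟 ρ →+* ZMod ℓ, Occurs Ψ ∧ ∀ π, Ψ (heckeT 𝔟 ρ π) = μ π := by
  have hex : ∀ t : heckeAlgebra 𝔟 ρ, ∃ a : ZMod ℓ,
      (t : Module.End (ZMod ℓ) (H1 (Gamma1 𝔟) ρ)) v = a • v := by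
    rintro ⟨t, ht⟩
    change ∃ a : ZMod ℓ, t v = a • v
    induction ht using Algebra.adjoin_induction with
    | mem t ht => obtain ⟨π, rfl⟩ := ht; exact ⟨_, hμ π⟩
    | algebraMap r => exact ⟨r, rfl⟩
    | add s t _ _ hs ht =>
      obtain ⟨a, ha⟩ := hs
      obtain ⟨b, hb⟩ := ht
      exact ⟨a + b, by rw [LinearMap.add_apply, ha, hb, add_smul]⟩
    | mul s t _ _ hs ht =>
      obtain ⟨a, ha⟩ := hs
      obtain ⟨b, hb⟩ := ht
      exact ⟨a * b, by rw [Module.End.mul_apply, hb, map_smul, ha, smul_smul, mul_comm]⟩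
  choose φ hφ using hex
  have huniq : ∀ (t : heckeAlgebra 𝔟 ρ) (a : ZMod ℓ),
      (t : Module.End (ZMod ℓ) (H1 (Gamma1 𝔟) ρ)) v = a • v → φ t = a := fun t a h =>
    smul_left_injective (ZMod ℓ) hv ((hφ t).symm.trans h)
  let Ψ : heckeAlgebra 𝔟 ρ →+* ZMod ℓ :=
    { toFun := φ
      map_one' := huniq _ _ (one_smul _ _).symm
      map_zero' := huniq _ _ (zero_smul _ _).symm
      map_add' := fun s t => huniq _ _ (by
        rw [Subalgebra.coe_add, LinearMap.add_apply, hφ, hφ, add_smul])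
      map_mul' := fun s t => huniq _ _ (by
        rw [Subalgebra.coe_mul, Module.End.mul_apply, hφ, map_smul, hφ, smul_smul, mul_comm]) }
  exact ⟨Ψ, ⟨v, hv, hφ⟩, fun π => huniq _ _ (hμ π)⟩

end Systems

end

end Bianchi

theorem mainTheorem2
    (K : Type) [Field K] [NumberField K] [IsTotallyComplex K] (hK : Module.finrank ℚ K = 2)
    (hcl : classNumber K = 1)
    (ℓ : ℕ) [Fact ℓ.Prime]
    -- `ℓ = lam * lam'` splits into two non-associate primes
    (lam lam' : 𝓞 K) (hlam : Prime lam) (hlam' : Prime lam') (hne : ¬ Associated lam lam')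
    (hsplit : (ℓ : 𝓞 K) = lam * lam')
    -- the reduction maps modulo `lam` and `lam'`
    (τ₁ τ₂ : 𝓞 K →+* ZMod ℓ) (hτ₁ : RingHom.ker τ₁ = Ideal.span {lam})
    (hτ₂ : RingHom.ker τ₂ = Ideal.span {lam'})
    (𝔞 : Ideal (𝓞 K)) (h𝔞 : IsCoprime 𝔞 (Ideal.span {(ℓ : 𝓞 K)}))
    -- a finite dimensional (right) module `E` over `𝔽_ℓ[GL₂(𝓞/(ℓ))]`
    (E : Type) [AddCommGroup E] [Module (ZMod ℓ) E] [FiniteDimensional (ZMod ℓ) E]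
    (ρ : Representation (ZMod ℓ) (GL (Fin 2) (𝓞 K ⧸ Ideal.span {(ℓ : 𝓞 K)}))ᵐᵒᵖ E)
    (Φ : Bianchi.heckeAlgebra 𝔞 ρ →+* ZMod ℓ) (hΦ : Bianchi.Occurs Φ) :
    ∃ a b : ℕ, a ≤ ℓ - 2 ∧ b ≤ ℓ - 2 ∧
      ∃ Ψ : Bianchi.heckeAlgebra (𝔞 * Ideal.span {(ℓ : 𝓞 K)}) (Bianchi.trivialCoeff K ℓ)
          →+* ZMod ℓ,
        Bianchi.Occurs Ψ ∧
        ∀ π : Bianchi.PrimeAway K ℓ,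
          Φ (Bianchi.heckeT 𝔞 ρ π) =
            τ₁ π.1 ^ a * τ₂ π.1 ^ b *
              Ψ (Bianchi.heckeT (𝔞 * Ideal.span {(ℓ : 𝓞 K)}) (Bianchi.trivialCoeff K ℓ) π) := by
  obtain ⟨e, he⟩ := Bianchi.exists_equiv_prod hlam hlam' hne hsplit hτ₁ hτ₂
  obtain ⟨v, hv, hΦv⟩ := hΦ
  obtain ⟨c, rfl⟩ := Bianchi.H1π_surjective ρ v
  have hfin : ∀ (𝔟 : Ideal (𝓞 K)) (π : Bianchi.PrimeAway K ℓ),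
      Finite (Bianchi.HeckeIndex (Bianchi.Gamma1 𝔟) π.1) := fun 𝔟 π =>
    Bianchi.finite_heckeIndex 𝔟 π.2.1.ne_zero
  have hp : ∀ π : Bianchi.PrimeAway K ℓ,
      IsUnit (Ideal.Quotient.mk (Ideal.span {(ℓ : 𝓞 K)}) π.1) := fun π =>
    Bianchi.isUnit_mk_of_isCoprime π.2.2
  have hc : c.1 ∉ groupCohomology.coboundaries₁ (Bianchi.coeff (Bianchi.Gamma1 𝔞) ρ) := fun h =>
    hv ((groupCohomology.H1π_eq_zero_iff c).mpr h)
  have hμ : ∀ π : Bianchi.PrimeAway K ℓ,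
      Bianchi.heckeFun ρ (hp π) c.1 - Φ (Bianchi.heckeT 𝔞 ρ π) • c.1 ∈
        groupCohomology.coboundaries₁ (Bianchi.coeff (Bianchi.Gamma1 𝔞) ρ) := by
    intro π
    have h1 := (Bianchi.heckeOperator_H1π ρ π.2.1.ne_zero (hp π) c).symm.trans
      (hΦv (Bianchi.heckeT 𝔞 ρ π))
    have h2 := (groupCohomology.H1π_eq_zero_iff (Bianchi.heckeCocycles ρ π.2.1.ne_zero (hp π) c -
      Φ (Bianchi.heckeT 𝔞 ρ π) • c)).mp (by
        rw [map_sub, map_smul, sub_eq_zero]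
        exact h1)
    exact h2
  obtain ⟨a, b, ha, hb, w, hw, hw0, ν, hν, hμν⟩ := Bianchi.exists_eigencocycle e he h𝔞 ρ
    (p := fun π : Bianchi.PrimeAway K ℓ => π.1) (fun π => π.2.1) hp c.2 hc hμ
  -- Coboundaries with trivial coefficients vanish.
  have hw' : groupCohomology.H1π _ ⟨w, hw⟩ ≠ 0 := by
    intro h
    obtain ⟨x, hx⟩ := (groupCohomology.H1π_eq_zero_iff _).mp h
    exact hw0 (hx.symm.trans (Bianchi.bd_trivialRep (Ideal.span {(ℓ : 𝓞 K)}) _ x))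
  obtain ⟨Ψ, hΨ, hΨν⟩ := Bianchi.exists_occurs (ρ := Bianchi.trivialCoeff K ℓ) hw' (μ := ν)
    (fun π => by
      refine (Bianchi.heckeOperator_H1π (Bianchi.trivialCoeff K ℓ) π.2.1.ne_zero (hp π)
        ⟨w, hw⟩).trans ?_
      rw [← map_smul]
      exact congrArg _ (Subtype.ext (hν π)))
  exact ⟨a, b, ha, hb, Ψ, hΨ, fun π => by rw [hΨν, hμν]⟩
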